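/- **Setting.** Let $\ell, n_c\ge 1$ be integers, $\kappa\ge 0$, $\mu_H=\sqrt{\kappa/(1+\kappa)}$ and $\sigma_H^2=1/(1+\kappa)$. Consider the Rician memoryless block-fading channel $Y_k=H_kx_k+W_k$, $k=1,\dots,\ell$, with $x_k,Y_k\in\mathbb C^{n_c}$, $H_k\sim\mathcal{CN}(\mu_H,\sigma_H^2)$ and $W_k\sim\mathcal{CN}(0,I_{n_c})$, all $H_k$ and $W_k$ being mutually independent. An $(\ell,n_c,M,\epsilon,\rho)$-code consists of codewords $c_m=[c_{m,1},\dots,c_{m,\ell}]$, $m=1,\dots,M$, with $\|c_{m,k}\|^2=n_c\rho$ for all $m,k$, and a (measurable) decoder $g:\mathbb C^{n_c\ell}\to\{1,\dots,M\}$ whose average error probability over uniformly distributed messages is at most $\epsilon$. The maximum coding rate is $$R^*(\ell,n_c,\epsilon,\rho)=\sup\Big\{\tfrac{\log_2M}{\ell n_c}:\ \exists\,(\ell,n_c,M,\epsilon,\rho)\text{-code}\Big\}.$$ **Theorem (RCUs–PAT–NN achievability bound).** Let $n_p,n_d\ge 1$ be integers with $n_p+n_d=n_c$, and let $\rho_p>0$,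 $\rho_d\ge 0$ satisfy $n_p\rho_p+n_d\rho_d=n_c\rho$. For an integer $M\ge1$ define $$\epsilon_{\rm ub}(M)=\min_{s\ge 0}\ \mathbb E\Big[\exp\Big\{-\Big[\sum_{k=1}^{\ell}T_k^s-\log(M-1)\Big]^+\Big\}\Big],$$ where $\log 0=-\infty$ and $e^{-\infty}=0$ when $M=1$, and $$T_k^s=s\big(\|\overline W_k\|^2-\|\widetilde W_k\|^2\big)+s\,n_d\rho_d|\widehat H_k|^2-\log\Gamma(n_d)+(n_d-1)\log\big(s|\widehat H_k|\,\|\overline W_k\|\sqrt{n_d\rho_d}\big)-\log I_{n_d-1}\big(2s|\widehat H_k|\,\|\overline W_k\|\sqrt{n_d\rho_d}\big)$$ (extended by its limit value where the argument of the last two logarithms vanishes). Here $I_\nu$ is the modified Bessel function of the first kind, $$\overline W_k=\begin{bmatrix}H_k\sqrt{n_d\rho_d}\\ 0_{n_d-1}\end{bmatrix}+W_k,\qquad \widetilde W_k=\begin{bmatrix}(H_k-\widehat H_k)\sqrt{n_d\rho_d}\\ 0_{n_d-1}\end{bmatrix}+W_k ,$$ and the triples $(H_k,\widehat H_k,W_k)$,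 $k=1,\dots,\ell$, are i.i.d. with law $P_HP_{\widehat H|H}P_W$, where $P_H=\mathcal{CN}(\mu_H,\sigma_H^2)$, $P_{\widehat H|H=h}=\mathcal{CN}(h,1/(n_p\rho_p))$ and $P_W=\mathcal{CN}(0,I_{n_d})$. Then the following hold. 1. The minimum in the definition of $\epsilon_{\rm ub}(M)$ is attained, for every $M\ge 1$. 2. For every $M\ge1$ and all pilot vectors $p_1,\dots,p_\ell\in\mathbb C^{n_p}$ whose entries all have squared modulus $\rho_p$, there is an $(\ell,n_c,M,\epsilon_{\rm ub}(M),\rho)$-code of the following form. Block $k$ of each codeword is $[p_k,x_k]$ with $x_k\in\mathbb C^{n_d}$, $\|x_k\|^2=n_d\rho_d$. Given the received blocks $[y_k^{(p)},y_k^{(d)}]$, the decoder forms the maximum-likelihood channel estimates $\widehat h_k=p_k^{\mathsf H}y_k^{(p)}/\|p_k\|^2$ and outputs a message that maximizes the scaled nearest-neighbour metric $\prod_{k=1}^{\ell}\exp(-\|y_k^{(d)}-\widehat h_kx_k\|^2)$. 3. For every $0\le\epsilon<1$, the set $\{\log_2(M)/(n_c\ell):\ M\ge1,\ \epsilon_{\rm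 ub}(M)\le\epsilon\}$ has a maximum, $R^*(\ell,n_c,\epsilon,\rho)$ is finite, and $$R^*(\ell,n_c,\epsilon,\rho)\ \ge\ \max\Big\{\tfrac{\log_2M}{n_c\ell}:\ M\ge1,\ \epsilon_{\rm ub}(M)\le\epsilon\Big\}.$$ -/

import Mathlib

open MeasureTheory ProbabilityTheory

noncomputable section

namespace BlockFading

/-! ### Complex Gaussian laws -/

/-- `CN(0, v)`: independent real and imaginary parts, each `N(0, v / 2)`. -/
def cgaussZero (v : ℝ) : Measure ℂ :=
  ((gaussianReal 0 (v / 2).toNNReal).prod (gaussianReal 0 (v / 2).toNNReal)).map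
    Complex.measurableEquivRealProd.symm

/-- The circularly-symmetric complex Gaussian law `CN(μ, v)` with mean `μ` and variance `v`. -/
def cgauss (μ : ℂ) (v : ℝ) : Measure ℂ :=
  (cgaussZero v).map (fun z => μ + z)

instance (v : ℝ) : IsProbabilityMeasure (cgaussZero v) :=
  Measure.isProbabilityMeasure_map Complex.measurableEquivRealProd.symm.measurable.aemeasurable

instance (μ : ℂ) (v : ℝ) : IsProbabilityMeasure (cgauss μ v) :=
  Measure.isProbabilityMeasure_map (measurable_const_add μ).aemeasurable

theorem measurable_cgauss (v : ℝ) : Measurable (fun μ : ℂ => cgauss μ v) := by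
  refine Measure.measurable_of_measurable_coe _ (fun s hs => ?_)
  have h : (fun μ : ℂ => cgauss μ v s) = fun μ : ℂ =>
      cgaussZero v (Prod.mk μ ⁻¹' ((fun p : ℂ × ℂ => p.1 + p.2) ⁻¹' s)) := by
    funext μ
    rw [cgauss, Measure.map_apply (measurable_const_add μ) hs]
    rfl
  rw [h]
  exact measurable_measure_prodMk_left ((measurable_fst.add measurable_snd) hs)

/-- The conditional law `P(· | H = h) = CN(h, v)`, as a Markov kernel in `h`. -/
def cgaussKernel (v : ℝ) : Kernel ℂ ℂ := ⟨fun h => cgauss h v, measurable_cgauss v⟩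

instance (v : ℝ) : IsMarkovKernel (cgaussKernel v) :=
  ⟨fun h => inferInstanceAs (IsProbabilityMeasure (cgauss h v))⟩

/-- The law `CN(0, I_n)` on `ℂⁿ`. -/
def noiseLaw (n : ℕ) : Measure (Fin n → ℂ) := Measure.pi (fun _ => cgauss 0 1)

/-- The `ℓ²`-norm on `ℂⁿ`. -/
def l2norm {n : ℕ} (v : Fin n → ℂ) : ℝ := Real.sqrt (∑ i, ‖v i‖ ^ 2)

/-! ### The Rician memoryless block-fading channel, codes, and the maximum coding rate -/

/-- The mean of the fading coefficient, for Rician factor `κ`. -/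
def fadingMean (κ : ℝ) : ℝ := Real.sqrt (κ / (1 + κ))

/-- The variance of the fading coefficient, for Rician factor `κ`. -/
def fadingVar (κ : ℝ) : ℝ := (1 + κ)⁻¹

/-- The law of the fading coefficient. -/
def fadingLaw (κ : ℝ) : Measure ℂ := cgauss (fadingMean κ : ℂ) (fadingVar κ)

/-- The law of the channel output `(Y_1, …, Y_ℓ)`, `Y_k = H_k x_k + W_k`, when the input is
`x = (x_1, …, x_ℓ)`, with all `H_k` and all `W_k` mutually independent. -/
def channelLaw (κ : ℝ) {ℓ n : ℕ} (x : Fin ℓ → Fin n → ℂ) : Measure (Fin ℓ → Fin n → ℂ) :=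
  ((Measure.pi (fun _ : Fin ℓ => fadingLaw κ)).prod
    (Measure.pi (fun _ : Fin ℓ => noiseLaw n))).map
      (fun p k i => p.1 k * x k i + p.2 k i)

/-- The pair of the encoder `f` and the decoder `g` is an `(ℓ, nc, M, ε, ρ)`-code. Messages are
the elements of `Fin M`; the message is uniformly distributed. -/
def IsCode (κ : ℝ) (ℓ nc M : ℕ) (ε ρ : ℝ)
    (f : Fin M → Fin ℓ → Fin nc → ℂ) (g : (Fin ℓ → Fin nc → ℂ) → Fin M) : Prop :=
  (∀ m k, l2norm (f m k) ^ 2 = nc * ρ) ∧ Measurable g ∧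
    (1 / (M : ℝ)) * ∑ j, (channelLaw κ (f j)).real {y | g y ≠ j} ≤ ε

/-- The rates, in bits per channel use, of the `(ℓ, nc, M, ε, ρ)`-codes. -/
def codeRates (κ : ℝ) (ℓ nc : ℕ) (ε ρ : ℝ) : Set ℝ :=
  {r | ∃ (M : ℕ) (f : Fin M → Fin ℓ → Fin nc → ℂ) (g : (Fin ℓ → Fin nc → ℂ) → Fin M),
    IsCode κ ℓ nc M ε ρ f g ∧ r = Real.logb 2 M / (ℓ * nc)}

/-- The maximum coding rate `R*(ℓ, nc, ε, ρ)`. -/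
def maxRate (κ : ℝ) (ℓ nc : ℕ) (ε ρ : ℝ) : ℝ := sSup (codeRates κ ℓ nc ε ρ)

/-! ### Pilot-assisted transmission with nearest-neighbour decoding -/

/-- The pilot part (first `np` entries) of a block. -/
def pilotPart {np nd : ℕ} (x : Fin (np + nd) → ℂ) : Fin np → ℂ := fun i => x (Fin.castAdd nd i)

/-- The data part (last `nd` entries) of a block. -/
def dataPart {np nd : ℕ} (x : Fin (np + nd) → ℂ) : Fin nd → ℂ := fun i => x (Fin.natAdd np i)

/-- The maximum-likelihood estimate of the fading coefficient from the received vector `y` when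
the pilot vector is `x`. -/
def mlEstimate {np : ℕ} (x y : Fin np → ℂ) : ℂ :=
  (∑ i, (starRingEnd ℂ) (x i) * y i) / ((l2norm x ^ 2 : ℝ) : ℂ)

/-- The scaled nearest-neighbour decoding metric, within one block, which treats the
maximum-likelihood channel estimate as perfect. -/
def nnMetric {np nd : ℕ} (x y : Fin (np + nd) → ℂ) : ℝ :=
  Real.exp (-(l2norm (fun i =>
    dataPart y i - mlEstimate (pilotPart x) (pilotPart y) * dataPart x i)) ^ 2)

/-- The decoder `g` always outputs a message whose codeword maximizes the product over the
blocks of the nearest-neighbour metric. -/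
def IsNNDecoder {ℓ np nd M : ℕ} (f : Fin M → Fin ℓ → Fin (np + nd) → ℂ)
    (g : (Fin ℓ → Fin (np + nd) → ℂ) → Fin M) : Prop :=
  ∀ y m, ∏ k, nnMetric (f m k) (y k) ≤ ∏ k, nnMetric (f (g y) k) (y k)

/-! ### The bound on the error probability -/

/-- The modified Bessel function of the first kind `I_ν`, of nonnegative integer order. -/
def besselI (ν : ℕ) (z : ℝ) : ℝ :=
  ∑' m : ℕ, (z / 2) ^ (2 * m + ν) / ((m.factorial : ℝ) * ((m + ν).factorial : ℝ))

/-- The vector `(a, 0, …, 0)`. -/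
def firstCoord {n : ℕ} (a : ℂ) : Fin n → ℂ := fun i => if (i : ℕ) = 0 then a else 0

/-- `w̄ = (h √(nd ρd), 0, …, 0) + w`. -/
def wBar {nd : ℕ} (ρd : ℝ) (h : ℂ) (w : Fin nd → ℂ) : Fin nd → ℂ :=
  firstCoord (h * (Real.sqrt (nd * ρd) : ℂ)) + w

/-- `w̃ = ((h - ĥ) √(nd ρd), 0, …, 0) + w`, where `e` stands for the estimate `ĥ`. -/
def wTilde {nd : ℕ} (ρd : ℝ) (h e : ℂ) (w : Fin nd → ℂ) : Fin nd → ℂ :=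
  firstCoord ((h - e) * (Real.sqrt (nd * ρd) : ℂ)) + w

/-- The random variable `T^s` of one block, as a function of the fading coefficient `h`, its
estimate `e`, and the noise `w`. The argument of the last two logarithms vanishes only if `s = 0`,
`ρd = 0`, `e = 0` or `wBar = 0`. The last two have probability zero, and in the first two
`Real.log 0 = 0` gives a `T^s ≤ 0` where the limit value is `0`, which leaves `rcusAt` the same. -/
def tStat {nd : ℕ} (ρd s : ℝ) (h e : ℂ) (w : Fin nd → ℂ) : ℝ :=
  s * (l2norm (wBar ρd h w) ^ 2 - l2norm (wTilde ρd h e w) ^ 2) + s * nd * ρd * ‖e‖ ^ 2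
    - Real.log (Real.Gamma nd)
    + ((nd : ℝ) - 1) * Real.log (s * ‖e‖ * l2norm (wBar ρd h w) * Real.sqrt (nd * ρd))
    - Real.log (besselI (nd - 1) (2 * s * ‖e‖ * l2norm (wBar ρd h w) * Real.sqrt (nd * ρd)))

/-- The joint law `P_H P_{Ĥ|H} P_W` of the fading coefficient, its estimate and the noise in the
data symbols of one block, where `P_{Ĥ|H=h} = CN(h, 1 / (np ρp))`. -/
def blockLaw (κ : ℝ) (np nd : ℕ) (ρp : ℝ) : Measure ((ℂ × ℂ) × (Fin nd → ℂ)) :=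
  ((fadingLaw κ) ⊗ₘ (cgaussKernel (1 / (np * ρp)))).prod (noiseLaw nd)

/-- `exp(-[t - log(M - 1)]⁺)`, with `log 0 = -∞` and `exp(-∞) = 0` if `M = 1`. -/
def rcusTerm (M : ℕ) (t : ℝ) : ℝ :=
  if M = 1 then 0 else Real.exp (-(max 0 (t - Real.log ((M : ℝ) - 1))))

/-- `E[exp(-[∑ T_k^s - log(M - 1)]⁺)]`, the blocks being independent and identically
distributed. -/
def rcusAt (κ : ℝ) (ℓ np nd : ℕ) (ρp ρd : ℝ) (M : ℕ) (s : ℝ) : ℝ :=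
  ∫ b, rcusTerm M (∑ k, tStat ρd s (b k).1.1 (b k).1.2 (b k).2)
    ∂(Measure.pi (fun _ : Fin ℓ => blockLaw κ np nd ρp))

/-- The infimum over `s ≥ 0` of `rcusAt`. -/
def epsUB (κ : ℝ) (ℓ np nd : ℕ) (ρp ρd : ℝ) (M : ℕ) : ℝ :=
  sInf (rcusAt κ ℓ np nd ρp ρd M '' Set.Ici 0)

end BlockFading

end

open BlockFading

/-! ### Complex Gaussian vectors and unitary invariance -/

noncomputable section
namespace BlockFading

open scoped ENNReal
open WithLp (toLp ofLp)

/-! The achievability part is random coding on spheres. With the pilots fixed, the data part of each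
codeword block is drawn independently and uniformly on the complex sphere of radius R = √(nd ρd).
The decoder can err only if some competitor x' has total distance ∑ ‖y_k - ĥ_k x'_k‖² at most that
of the sent word. Given the sent word, the fading and the noise, a union bound over the M - 1
competitors, capped at 1, gives min(1, (M - 1) p), where p is the probability that a single random
competitor is this close (`exists_codebook`). A Chernoff bound with parameter s factors p over the
blocks. Since all inputs have the same norm, the quadratic terms cancel and only the spherical mean
of exp(2 Re⟨y, x'⟩) remains. That mean is a normalized Bessel function
(`lintegral_exp_reInner_shellLaw`), so p ≤ exp(-∑ `infoDensity`) (`measure_closer_le`), and min(1,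
(M - 1) exp(-t)) is `rcusTerm`.

The expectation does not depend on the sent word. Rotating each x_k onto the first axis preserves
the Gaussian noise, and the estimation error is a linear functional of the pilot noise, independent
of the data noise. Each block therefore has law `blockLaw` (`map_eq_blockLaw`), and the information
density differs from `tStat` only by conventions in degenerate cases, which make `tStat` no larger.

The minimum over s is attained because, for M ≥ 2, the bound extends continuously to s = 0 with
value 1 there and tends to 1 at infinity (`tendsto_rcusExt_atTop`). The limit holds because almost
surely the Bessel term outgrows the linear term in s.

The rate is finite because, outside an event of small probability, the output lies in a fixed ball
and has a density bounded uniformly over codewords (`channelLaw_le`). Disjoint decoding regions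
share the finite volume of that ball, which bounds M. The set of admissible M is then finite, and it
contains 1. -/

theorem cgauss_zero (v : ℝ) : cgauss 0 v = cgaussZero v := by
  simp [cgauss]

/-- Here ℂ is a real inner product space, and each of the two components has variance v/2, whence
the 4. Dependence on `t` through its norm alone is the source of every rotation invariance below. -/
theorem charFun_cgaussZero {v : ℝ} (hv : 0 ≤ v) (t : ℂ) :
    charFun (cgaussZero v) t = Complex.exp (-(v * ‖t‖ ^ 2 / 4 : ℝ)) := by
  have h : charFun (cgaussZero v) t =
      ∫ p : ℝ × ℝ, Complex.exp ((t.re * p.1 : ℝ) * Complex.I) *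
        Complex.exp ((t.im * p.2 : ℝ) * Complex.I)
        ∂((gaussianReal 0 (v / 2).toNNReal).prod (gaussianReal 0 (v / 2).toNNReal)) := by
    rw [charFun_apply, cgaussZero, integral_map_equiv]
    refine integral_congr_ae (ae_of_all _ fun p => ?_)
    simp only [← Complex.exp_add]
    congr 1
    simp [Complex.inner]
    ring
  rw [h, integral_prod_mul (fun x : ℝ => Complex.exp ((t.re * x : ℝ) * Complex.I))
    (fun x : ℝ => Complex.exp ((t.im * x : ℝ) * Complex.I))]
  have h2 := fun r : ℝ => charFun_gaussianReal (μ := 0) (v := (v / 2).toNNReal) r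
  simp only [charFun_apply_real] at h2
  push_cast
  rw [h2, h2, ← Complex.exp_add]
  congr 1
  have ht : (‖t‖ : ℂ) ^ 2 = t.re ^ 2 + t.im ^ 2 := by
    rw [← Complex.ofReal_pow, Complex.sq_norm, Complex.normSq_apply]
    push_cast
    ring
  rw [ht]
  simp only [Real.coe_toNNReal _ (div_nonneg hv zero_le_two)]
  push_cast
  ring

theorem l2norm_eq_norm {n : ℕ} (v : Fin n → ℂ) : l2norm v = ‖toLp 2 v‖ := by
  rw [l2norm, EuclideanSpace.norm_eq]

theorem charFun_noiseLaw {n : ℕ} (t : EuclideanSpace ℂ (Fin n)) :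
    charFun ((noiseLaw n).map (toLp 2)) t = Complex.exp (-(‖t‖ ^ 2 / 4 : ℝ)) := by
  rw [noiseLaw, charFun_pi]
  simp only [cgauss_zero, charFun_cgaussZero zero_le_one]
  rw [← Complex.exp_sum, EuclideanSpace.norm_sq_eq]
  congr 1
  push_cast
  rw [Finset.sum_div, ← Finset.sum_neg_distrib]
  simp

/-- A unitary map of `EuclideanSpace ℂ (Fin n)`, acting on `Fin n → ℂ`. -/
def unitaryAct {n : ℕ} (U : EuclideanSpace ℂ (Fin n) ≃ₗᵢ[ℂ] EuclideanSpace ℂ (Fin n))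
    (v : Fin n → ℂ) : Fin n → ℂ := ofLp (U (toLp 2 v))

section unitaryAct
variable {n : ℕ} (U : EuclideanSpace ℂ (Fin n) ≃ₗᵢ[ℂ] EuclideanSpace ℂ (Fin n))

theorem unitaryAct_add (v w : Fin n → ℂ) :
    unitaryAct U (v + w) = unitaryAct U v + unitaryAct U w := by
  simp [unitaryAct]

theorem unitaryAct_smul (c : ℂ) (v : Fin n → ℂ) :
    unitaryAct U (c • v) = c • unitaryAct U v := by
  simp [unitaryAct]

theorem l2norm_unitaryAct (v : Fin n → ℂ) : l2norm (unitaryAct U v) = l2norm v := by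
  simp [l2norm_eq_norm, unitaryAct]

theorem measurable_unitaryAct : Measurable (unitaryAct U) := by
  have : Continuous (unitaryAct U) := by
    unfold unitaryAct
    fun_prop
  exact this.measurable

theorem noiseLaw_map_unitaryAct : (noiseLaw n).map (unitaryAct U) = noiseLaw n := by
  have hm : Measurable (toLp 2 : (Fin n → ℂ) → EuclideanSpace ℂ (Fin n)) := by fun_prop
  have hU : Measurable U := U.continuous.measurable
  have : IsProbabilityMeasure (noiseLaw n) := by unfold noiseLaw; infer_instance
  have := Measure.isProbabilityMeasure_map (μ := noiseLaw n) hm.aemeasurable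
  have key : ((noiseLaw n).map (toLp 2)).map U = (noiseLaw n).map (toLp 2) := by
    have := Measure.isProbabilityMeasure_map (μ := (noiseLaw n).map (toLp 2)) hU.aemeasurable
    refine Measure.ext_of_charFun (E := EuclideanSpace ℂ (Fin n)) (funext fun t => ?_)
    have h1 : charFun (((noiseLaw n).map (toLp 2)).map U) t
        = charFun ((noiseLaw n).map (toLp 2)) (U.symm t) := by
      rw [charFun_apply, charFun_apply, integral_map hU.aemeasurable (by fun_prop)]
      refine integral_congr_ae (ae_of_all _ fun x => ?_)
      -- Polarization: the real inner product is determined by norms, which `U` preserves.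
      have : inner ℝ (U x) t = inner ℝ x (U.symm t) := by
        rw [real_inner_eq_norm_add_mul_self_sub_norm_mul_self_sub_norm_mul_self_div_two,
          real_inner_eq_norm_add_mul_self_sub_norm_mul_self_sub_norm_mul_self_div_two,
          U.norm_map, U.symm.norm_map, ← U.norm_map (x + U.symm t), map_add, U.apply_symm_apply]
      simp only [this]
    rw [h1, charFun_noiseLaw, charFun_noiseLaw, U.symm.norm_map]
  have h2 : unitaryAct U = (ofLp : EuclideanSpace ℂ (Fin n) → _) ∘ (U ∘ toLp 2) := rfl
  rw [h2, ← Measure.map_map (by fun_prop) (hU.comp hm), ← Measure.map_map hU hm, key,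
    Measure.map_map (by fun_prop) hm]
  exact Measure.map_id

end unitaryAct

instance (n : ℕ) : IsProbabilityMeasure (noiseLaw n) := by unfold noiseLaw; infer_instance

instance (κ : ℝ) : IsProbabilityMeasure (fadingLaw κ) := by unfold fadingLaw; infer_instance

/-- The characteristic function of ∑ a_i w_i at t is that of w at the vector t·conj(a), of norm
|t|‖a‖. This serves both for moments of projections and for the law of the channel-estimation error.
-/
theorem noiseLaw_map_linear {n : ℕ} (a : Fin n → ℂ) :
    (noiseLaw n).map (fun w => ∑ i, a i * w i) = cgaussZero (l2norm a ^ 2) := by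
  have hm : Measurable (toLp 2 : (Fin n → ℂ) → EuclideanSpace ℂ (Fin n)) := by fun_prop
  have hf : Measurable (fun w : Fin n → ℂ => ∑ i, a i * w i) := by fun_prop
  have := Measure.isProbabilityMeasure_map (μ := noiseLaw n) hf.aemeasurable
  refine Measure.ext_of_charFun (funext fun t => ?_)
  rw [charFun_cgaussZero (sq_nonneg _)]
  have h := charFun_noiseLaw (toLp 2 (fun i => t * (starRingEnd ℂ) (a i)))
  rw [charFun_apply, integral_map hm.aemeasurable (by fun_prop)] at h
  rw [charFun_apply, integral_map hf.aemeasurable (by fun_prop)]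
  convert h using 2
  · funext w
    simp only [PiLp.inner_apply, Complex.inner, Complex.ofReal_sum]
    congr 2
    rw [← Complex.ofReal_sum, ← Complex.re_sum, map_sum, Finset.mul_sum]
    congr 2
    refine Finset.sum_congr rfl fun i _ => ?_
    simp
    ring
  · rw [l2norm_eq_norm, EuclideanSpace.norm_sq_eq, EuclideanSpace.norm_sq_eq]
    simp only [norm_mul, RCLike.norm_conj, mul_pow]
    rw [← Finset.mul_sum]
    ring_nf

theorem l2norm_sq {n : ℕ} (v : Fin n → ℂ) : l2norm v ^ 2 = ∑ i, ‖v i‖ ^ 2 :=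
  Real.sq_sqrt (by positivity)

theorem l2norm_nonneg {n : ℕ} (v : Fin n → ℂ) : 0 ≤ l2norm v := Real.sqrt_nonneg _

/-- Every vector can be rotated onto the first coordinate axis. -/
theorem exists_unitaryAct_eq_firstCoord {n : ℕ} (x : Fin n → ℂ) :
    ∃ U : EuclideanSpace ℂ (Fin n) ≃ₗᵢ[ℂ] EuclideanSpace ℂ (Fin n),
      unitaryAct U x = firstCoord (l2norm x : ℂ) := by
  rcases eq_or_ne x 0 with rfl | hx
  · refine ⟨LinearIsometryEquiv.refl ℂ _, ?_⟩
    funext i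
    simp [unitaryAct, firstCoord, l2norm]
  obtain ⟨i, hi⟩ : ∃ i, x i ≠ 0 := by
    by_contra! h
    exact hx (funext h)
  have hn : 0 < n := i.pos
  have : NeZero n := ⟨hn.ne'⟩
  set v := toLp 2 x with hv
  have hv0 : ‖v‖ ≠ 0 := by
    rw [norm_ne_zero_iff]
    intro h
    apply hx
    have := congrArg ofLp h
    simpa [hv] using this
  set e : EuclideanSpace ℂ (Fin n) := ((‖v‖ : ℂ)⁻¹) • v with he
  have he1 : ‖e‖ = 1 := by
    rw [he, norm_smul]
    simp [hv0]
  -- The normalized vector is completed to an orthonormal basis in which it has index 0; taking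
  -- coordinates in that basis is the required unitary map.
  obtain ⟨b, hb⟩ := Orthonormal.exists_orthonormalBasis_extension_of_card_eq
    (𝕜 := ℂ) (E := EuclideanSpace ℂ (Fin n)) (ι := Fin n) (by simp) (v := fun _ => e)
    (s := {(0 : Fin n)}) (by
      constructor
      · intro i; simpa using he1
      · intro i j hij
        exact absurd (Subsingleton.elim i j) hij)
  have hb0 : b 0 = e := hb 0 rfl
  refine ⟨b.repr, ?_⟩
  have hve : v = (‖v‖ : ℂ) • e := by
    rw [he, smul_smul, mul_inv_cancel₀ (by exact_mod_cast hv0), one_smul]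
  funext j
  rw [unitaryAct, ← hv, hve, map_smul, ← hb0, b.repr_self, l2norm_eq_norm, ← hv]
  by_cases hj : j = 0
  · simp [firstCoord, hj]
  · have hj' : (j : ℕ) ≠ 0 := fun h => hj (Fin.ext h)
    simp [firstCoord, hj, hj']

end BlockFading
end

/-! ### Moments of Gaussian vectors -/

noncomputable section
namespace BlockFading

open scoped ENNReal Nat
open WithLp (toLp ofLp)

theorem cgaussZero_one_eq_withDensity :
    cgaussZero 1 = (volume : Measure ℂ).withDensity
      (fun z => ENNReal.ofReal (Real.pi⁻¹ * Real.exp (-‖z‖ ^ 2))) := by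
  have hv : (1 / 2 : ℝ).toNNReal ≠ 0 := by simp
  rw [cgaussZero, gaussianReal_of_var_ne_zero _ hv,
    prod_withDensity (measurable_gaussianPDF _ _) (measurable_gaussianPDF _ _)]
  refine Measure.ext_of_lintegral _ fun f hf => ?_
  rw [lintegral_map_equiv, lintegral_withDensity_eq_lintegral_mul _ (by fun_prop) (by fun_prop),
    lintegral_withDensity_eq_lintegral_mul _ (by fun_prop) hf,
    ← (Complex.volume_preserving_equiv_real_prod.symm).lintegral_comp_emb
      (MeasurableEquiv.measurableEmbedding _)]
  rw [← Measure.volume_eq_prod]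
  refine lintegral_congr fun p => ?_
  simp only [Pi.mul_apply]
  congr 1
  rw [gaussianPDF, gaussianPDF, ← ENNReal.ofReal_mul (gaussianPDFReal_nonneg _ _ _)]
  congr 1
  rw [gaussianPDFReal, gaussianPDFReal, mul_mul_mul_comm, ← Real.exp_add]
  congr 1
  · have hp : 2 * Real.pi * (1 / 2 : ℝ).toNNReal = Real.pi := by
      simp
      ring
    rw [hp, ← mul_inv, Real.mul_self_sqrt Real.pi_pos.le]
  · rw [Complex.sq_norm, Complex.normSq_apply]
    simp
    ring

theorem lintegral_norm_sq_pow_cgaussZero (k : ℕ) :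
    ∫⁻ z, ENNReal.ofReal (‖z‖ ^ 2) ^ k ∂(cgaussZero 1) = (k ! : ℝ≥0∞) := by
  rw [cgaussZero_one_eq_withDensity,
    lintegral_withDensity_eq_lintegral_mul _ (by fun_prop) (by fun_prop)]
  have h := Complex.integral_rpow_mul_exp_neg_rpow (p := 2) (q := 2 * k) one_le_two
    (by linarith [k.cast_nonneg (α := ℝ)])
  have e1 : (2 * (k : ℝ) + 2) / 2 = k + 1 := by ring
  rw [e1, Real.Gamma_nat_eq_factorial] at h
  have h' : ∫ z : ℂ, Real.pi⁻¹ * Real.exp (-‖z‖ ^ 2) * (‖z‖ ^ 2) ^ k = k ! := by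
    have : ∀ z : ℂ, Real.pi⁻¹ * Real.exp (-‖z‖ ^ 2) * (‖z‖ ^ 2) ^ k =
        Real.pi⁻¹ * (‖z‖ ^ (2 * k : ℝ) * Real.exp (-‖z‖ ^ (2 : ℝ))) := by
      intro z
      rw [← pow_mul, ← Real.rpow_natCast ‖z‖ (2 * k), ← Real.rpow_natCast ‖z‖ 2]
      push_cast
      ring
    simp_rw [this]
    rw [integral_const_mul, h]
    field_simp
  -- Integrability comes for free in the second goal: a non-integrable function would have Bochner
  -- integral 0, while the computed value is positive.
  rw [← ENNReal.ofReal_natCast, ← h', ofReal_integral_eq_lintegral_ofReal]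
  · refine lintegral_congr fun z => ?_
    simp only [Pi.mul_apply]
    rw [← ENNReal.ofReal_pow (by positivity), ← ENNReal.ofReal_mul (by positivity)]
  · by_contra hc
    rw [integral_undef hc] at h'
    exact absurd h'.symm (by positivity)
  · exact ae_of_all _ fun z => by positivity

theorem cgaussZero_map_re {v : ℝ} :
    (cgaussZero v).map Complex.re = gaussianReal 0 (v / 2).toNNReal := by
  rw [cgaussZero, Measure.map_map Complex.measurable_re (MeasurableEquiv.measurable _)]
  have : Complex.re ∘ Complex.measurableEquivRealProd.symm = Prod.fst := by
    funext p
    simp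
  rw [this]
  simp

/-- The real part is N(0, 1/2). For `k = 0` the truncated `2 * k - 1` is 0, and 0‼ = 1 is the right
value. -/
theorem lintegral_re_sq_pow_cgaussZero (k : ℕ) :
    ∫⁻ z, ENNReal.ofReal (z.re ^ 2) ^ k ∂(cgaussZero 1) =
      ENNReal.ofReal ((2 * k - 1 : ℕ)‼ / 2 ^ k) := by
  have e0 : ∫⁻ z, ENNReal.ofReal (z.re ^ 2) ^ k ∂(cgaussZero 1) =
      ∫⁻ x, ENNReal.ofReal (x ^ 2) ^ k ∂((cgaussZero 1).map Complex.re) := by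
    rw [lintegral_map (by fun_prop) Complex.measurable_re]
  have hv : (1 / 2 : ℝ).toNNReal ≠ 0 := by simp
  rw [e0, cgaussZero_map_re, gaussianReal_of_var_ne_zero _ hv,
    lintegral_withDensity_eq_lintegral_mul _ (by fun_prop) (by fun_prop)]
  have h := integral_rpow_mul_exp_neg_rpow (p := 2) (q := 2 * k) two_pos
    (by linarith [k.cast_nonneg (α := ℝ)])
  have e1 : (2 * (k : ℝ) + 1) / 2 = k + 1 / 2 := by ring
  rw [e1, Real.Gamma_nat_add_half] at h
  have h' : ∫ x : ℝ, gaussianPDFReal 0 (1 / 2 : ℝ).toNNReal x * (x ^ 2) ^ k =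
      (2 * k - 1 : ℕ)‼ / 2 ^ k := by
    have e : ∀ x : ℝ, gaussianPDFReal 0 (1 / 2 : ℝ).toNNReal x * (x ^ 2) ^ k =
        (fun y : ℝ => (Real.sqrt Real.pi)⁻¹ * (y ^ (2 * k : ℝ) * Real.exp (-y ^ (2 : ℝ)))) |x| := by
      intro x
      simp only
      have hp : 2 * Real.pi * (1 / 2 : ℝ).toNNReal = Real.pi := by
        simp
        ring
      rw [gaussianPDFReal, hp, ← sq_abs x, ← pow_mul, ← Real.rpow_natCast |x| (2 * k)]
      simp
      ring
    simp_rw [e]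
    rw [integral_comp_abs (f := fun y : ℝ => (Real.sqrt Real.pi)⁻¹ *
      (y ^ (2 * k : ℝ) * Real.exp (-y ^ (2 : ℝ)))), integral_const_mul, h]
    field_simp
  rw [← h', ofReal_integral_eq_lintegral_ofReal]
  · refine lintegral_congr fun z => ?_
    simp only [Pi.mul_apply, gaussianPDF]
    rw [← ENNReal.ofReal_pow (by positivity),
      ← ENNReal.ofReal_mul (gaussianPDFReal_nonneg _ _ _)]
  · by_contra hc
    rw [integral_undef hc] at h'
    exact absurd h'.symm (by positivity)
  · exact ae_of_all _ fun z => mul_nonneg (gaussianPDFReal_nonneg _ _ _) (by positivity)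

theorem sum_multichoose (n m : ℕ) :
    ∑ j ∈ Finset.range (m + 1), n.multichoose j = (n + 1).multichoose m := by
  induction m with
  | zero => simp
  | succ m ih => rw [Finset.sum_range_succ, ih, Nat.multichoose_succ_succ, add_comm]

theorem ascFactorial_eq_multichoose (n m : ℕ) : n.ascFactorial m = m ! * n.multichoose m := by
  rw [Nat.multichoose_eq]
  cases n with
  | zero =>
    cases m with
    | zero => simp
    | succ m => simp [Nat.zero_ascFactorial]
  | succ n => rw [Nat.ascFactorial_eq_factorial_mul_choose]; congr 2; omega

/-- Vandermonde's identity for the rising factorials of n and 1. It is the recursion that the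
moments of ‖g‖² satisfy when one coordinate is added. -/
theorem ascFactorial_succ_eq_sum (n m : ℕ) :
    ∑ k ∈ Finset.range (m + 1), m.choose k * (n.ascFactorial k * (m - k)!) =
      (n + 1).ascFactorial m := by
  rw [ascFactorial_eq_multichoose, ← sum_multichoose, Finset.mul_sum]
  refine Finset.sum_congr rfl fun k hk => ?_
  rw [ascFactorial_eq_multichoose,
    ← Nat.choose_mul_factorial_mul_factorial (Nat.lt_succ_iff.1 (Finset.mem_range.1 hk))]
  ring

theorem measurable_l2norm {n : ℕ} : Measurable (l2norm : (Fin n → ℂ) → ℝ) := by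
  unfold l2norm
  fun_prop

/-- The squared norm is a sum of n independent unit exponentials. Splitting off one coordinate and
expanding the power binomially gives an induction on n. -/
theorem lintegral_l2norm_sq_pow (n m : ℕ) :
    ∫⁻ g, ENNReal.ofReal (l2norm g ^ 2) ^ m ∂(noiseLaw n) = (n.ascFactorial m : ℝ≥0∞) := by
  induction n generalizing m with
  | zero =>
    cases m with
    | zero => simp
    | succ m => simp [l2norm, Nat.zero_ascFactorial]
  | succ n ih =>
    have hmp := (measurePreserving_piFinSuccAbove (fun _ : Fin (n + 1) => cgauss 0 1) 0).symm
    have hml := measurable_l2norm (n := n)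
    have hml' := measurable_l2norm (n := n + 1)
    rw [noiseLaw, ← hmp.lintegral_comp_emb (MeasurableEquiv.measurableEmbedding _),
      ← ascFactorial_succ_eq_sum]
    have e : ∀ p : ℂ × (Fin n → ℂ), ENNReal.ofReal (l2norm
        ((MeasurableEquiv.piFinSuccAbove (fun _ : Fin (n + 1) => ℂ) 0).symm p) ^ 2) ^ m =
        ∑ k ∈ Finset.range (m + 1), (m.choose k : ℝ≥0∞) *
          (ENNReal.ofReal (‖p.1‖ ^ 2) ^ (m - k) * ENNReal.ofReal (l2norm p.2 ^ 2) ^ k) := by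
      intro p
      have : l2norm ((MeasurableEquiv.piFinSuccAbove (fun _ : Fin (n + 1) => ℂ) 0).symm p) ^ 2 =
          l2norm p.2 ^ 2 + ‖p.1‖ ^ 2 := by
        rw [l2norm_sq, l2norm_sq, Fin.sum_univ_succ, add_comm]
        simp [MeasurableEquiv.piFinSuccAbove]
      rw [this, ENNReal.ofReal_add (by positivity) (by positivity), add_pow]
      refine Finset.sum_congr rfl fun k _ => ?_
      ring
    simp_rw [e]
    rw [lintegral_finsetSum _ (fun k _ => by fun_prop)]
    push_cast
    refine Finset.sum_congr rfl fun k _ => ?_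
    rw [lintegral_const_mul _ (by fun_prop), lintegral_prod_mul
        (f := fun z : ℂ => ENNReal.ofReal (‖z‖ ^ 2) ^ (m - k))
        (g := fun v : Fin n → ℂ => ENNReal.ofReal (l2norm v ^ 2) ^ k)
        (by fun_prop) (by fun_prop)]
    have := ih k
    rw [noiseLaw] at this
    rw [this, cgauss_zero, lintegral_norm_sq_pow_cgaussZero, mul_comm ((m - k)! : ℝ≥0∞)]

end BlockFading
end

/-! ### The normalized Bessel function -/

noncomputable section
namespace BlockFading

open scoped ENNReal Nat
open Filter Topology

/-- The entire function `∑ a^{2m} / (m! n(n+1)⋯(n+m-1))`, which is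
`Γ(n) I_{n-1}(2a) / a^{n-1}`. -/
def besselPhi (n : ℕ) (a : ℝ) : ℝ := ∑' m : ℕ, (a ^ 2) ^ m / (m ! * n.ascFactorial m)

section besselPhi
variable {n : ℕ}

theorem one_le_ascFactorial (hn : 0 < n) (m : ℕ) : 1 ≤ n.ascFactorial m := by
  obtain ⟨k, rfl⟩ : ∃ k, n = k + 1 := ⟨n - 1, by omega⟩
  exact Nat.ascFactorial_pos k m

theorem besselPhi_term_le (hn : 0 < n) {x r : ℝ} (hx : 0 ≤ x) (hr : x ≤ r) (m : ℕ) :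
    x ^ m / (m ! * n.ascFactorial m) ≤ r ^ m / m ! := by
  have h1 : (1 : ℝ) ≤ n.ascFactorial m := by exact_mod_cast one_le_ascFactorial hn m
  have h2 : (0 : ℝ) < m ! := by positivity
  calc x ^ m / (m ! * n.ascFactorial m) ≤ x ^ m / m ! :=
        div_le_div_of_nonneg_left (by positivity) h2 (by nlinarith)
    _ ≤ r ^ m / m ! := by gcongr

theorem summable_besselPhi (hn : 0 < n) (a : ℝ) :
    Summable fun m : ℕ => (a ^ 2) ^ m / (m ! * n.ascFactorial m : ℝ) :=
  Summable.of_nonneg_of_le (fun _ => by positivity)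
    (fun m => besselPhi_term_le hn (sq_nonneg a) le_rfl m) (Real.summable_pow_div_factorial _)

theorem continuous_besselPhi (hn : 0 < n) : Continuous (besselPhi n) := by
  rw [continuous_iff_continuousAt]
  intro a
  have h : ContinuousOn (besselPhi n) (Set.Icc (a - 1) (a + 1)) := by
    refine continuousOn_tsum (u := fun m => ((|a| + 1) ^ 2) ^ m / (m ! : ℝ))
      (fun m => by fun_prop) (Real.summable_pow_div_factorial _) fun m x hx => ?_
    have hx' : |x| ≤ |a| + 1 := by
      have h1 : |x - a| ≤ 1 := abs_le.2 ⟨by linarith [hx.1], by linarith [hx.2]⟩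
      calc |x| = |a + (x - a)| := by ring_nf
        _ ≤ |a| + |x - a| := abs_add_le _ _
        _ ≤ |a| + 1 := by linarith
    rw [Real.norm_of_nonneg (by positivity)]
    refine besselPhi_term_le hn (sq_nonneg x) ?_ m
    rw [← sq_abs x]
    gcongr
  exact h.continuousAt (Icc_mem_nhds (by linarith) (by linarith))

theorem one_le_besselPhi (hn : 0 < n) (a : ℝ) : 1 ≤ besselPhi n a := by
  have := (summable_besselPhi hn a).le_tsum 0 (fun _ _ => by positivity)
  simpa [besselPhi] using this

theorem besselPhi_zero (n : ℕ) : besselPhi n 0 = 1 := by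
  rw [besselPhi, tsum_eq_single 0]
  · simp
  · intro m hm
    simp [hm]

/-- The prefactor is exactly what the Γ and logarithm terms of `tStat` cancel. What is left is
entire and at least 1, so its logarithm is continuous even at a = 0. -/
theorem besselI_eq_besselPhi (hn : 0 < n) (a : ℝ) :
    besselI (n - 1) (2 * a) = a ^ (n - 1) / Real.Gamma n * besselPhi n a := by
  obtain ⟨k, rfl⟩ : ∃ k, n = k + 1 := ⟨n - 1, by omega⟩
  rw [besselI, besselPhi, ← tsum_mul_left]
  refine tsum_congr fun m => ?_
  have h := Nat.factorial_mul_ascFactorial k m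
  have h2 : ((k + m)! : ℝ) = k ! * (k + 1).ascFactorial m := by rw [← h]; push_cast; ring
  have h3 : (((k + 1).ascFactorial m : ℕ) : ℝ) ≠ 0 := by
    have := one_le_ascFactorial hn m
    positivity
  rw [Nat.add_sub_cancel]
  push_cast
  rw [Real.Gamma_nat_eq_factorial, add_comm m k, h2, pow_add, pow_mul]
  field_simp

theorem multichoose_le_pow (n m : ℕ) : n.multichoose m ≤ (m + 1) ^ n := by
  induction n generalizing m with
  | zero =>
    cases m <;> simp
  | succ n ih =>
    rw [← sum_multichoose, pow_succ', ← smul_eq_mul, ← Finset.card_range (m + 1),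
      ← Finset.sum_const, Finset.card_range]
    refine Finset.sum_le_sum fun j hj => (ih j).trans ?_
    have := Finset.mem_range.1 hj
    gcongr
    omega

/-- Up to a constant, `besselPhi` grows at least as `exp (2 d a)`, for every `d < 1`. -/
theorem exists_mul_exp_le_besselPhi (hn : 0 < n) {d : ℝ} (hd : 0 < d) (hd1 : d < 1) :
    ∃ C : ℝ, 0 < C ∧ ∀ a : ℝ, C * Real.exp (2 * d * a) ≤ besselPhi n a := by
  have hlim := tendsto_pow_const_mul_const_pow_of_abs_lt_one (n + 1) (r := d ^ 2)
    (by rw [abs_of_pos (by positivity)]; nlinarith)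
  obtain ⟨B, hB⟩ := hlim.bddAbove_range
  set K : ℝ := 2 * (max B 1) / d ^ 2 with hK
  have hKpos : 0 < K := by positivity
  -- Since d < 1, the geometric factor absorbs every polynomial loss. The power n covers
  -- `multichoose`, and one more covers the 2m + 1 of the central binomial bound. `hB` is read at m
  -- + 1, hence the division by d² in `K`.
  have hterm : ∀ m : ℕ, 2 * ((m : ℝ) + 1) ^ (n + 1) * (d ^ 2) ^ m ≤ K := by
    intro m
    have := hB (Set.mem_range_self (m + 1))
    push_cast at this
    rw [hK, le_div_iff₀ (by positivity)]
    have h2 : B ≤ max B 1 := le_max_left _ _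
    calc 2 * ((m : ℝ) + 1) ^ (n + 1) * (d ^ 2) ^ m * d ^ 2
        = 2 * (((m : ℝ) + 1) ^ (n + 1) * (d ^ 2) ^ (m + 1)) := by ring
      _ ≤ 2 * max B 1 := by linarith
  refine ⟨1 / (2 * K), by positivity, fun a => ?_⟩
  -- A termwise comparison of even power series. With (2m)! = C(2m, m) m!² it reduces to (4d²)^m ·
  -- `n.multichoose m` ≤ K C(2m, m), and C(2m, m) ≥ 4^m / (2m + 1).
  have hc : K⁻¹ * Real.cosh (2 * d * a) ≤ besselPhi n a := by
    rw [Real.cosh_eq_tsum, ← tsum_mul_left]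
    refine Summable.tsum_le_tsum (fun m => ?_)
      ((Real.hasSum_cosh _).summable.mul_left _) (summable_besselPhi hn a)
    have h1 : ((m : ℝ) + 1) ^ n * ((2 * m + 1) * m.centralBinom) ≥
        n.multichoose m * 4 ^ m := by
      have e1 : (n.multichoose m : ℝ) ≤ (m + 1) ^ n := by exact_mod_cast multichoose_le_pow n m
      have e2 : (4 : ℝ) ^ m ≤ (2 * m + 1) * m.centralBinom := by
        exact_mod_cast Nat.four_pow_le_two_mul_add_one_mul_central_binom m
      gcongr
    have h2 : ((2 * m)! : ℝ) = m.centralBinom * (m ! * m !) := by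
      have := Nat.choose_mul_factorial_mul_factorial (show m ≤ 2 * m by omega)
      rw [show 2 * m - m = m by omega] at this
      rw [Nat.centralBinom, ← this]
      push_cast
      ring
    have h3 : (n.ascFactorial m : ℝ) = m ! * n.multichoose m := by
      exact_mod_cast ascFactorial_eq_multichoose n m
    have hpos : (0 : ℝ) < n.ascFactorial m := by
      exact_mod_cast one_le_ascFactorial hn m
    have hpos2 : (0 : ℝ) < m.centralBinom := by exact_mod_cast m.centralBinom_pos
    rw [h2, inv_mul_eq_div, div_div, div_le_div_iff₀ (by positivity) (by positivity), h3]
    have h4 := hterm m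
    have e3 : (2 * d * a) ^ (2 * m) = (a ^ 2) ^ m * ((d ^ 2) ^ m * 4 ^ m) := by
      rw [pow_mul, ← mul_pow, ← mul_pow]
      ring
    rw [e3]
    have key : (d ^ 2) ^ m * 4 ^ m * n.multichoose m ≤ K * m.centralBinom := by
      calc (d ^ 2) ^ m * 4 ^ m * n.multichoose m
          ≤ (d ^ 2) ^ m * (((m : ℝ) + 1) ^ n * ((2 * m + 1) * m.centralBinom)) := by
            rw [mul_assoc, mul_comm ((4 : ℝ) ^ m)]
            gcongr
        _ ≤ (d ^ 2) ^ m * (((m : ℝ) + 1) ^ n * ((2 * (m + 1)) * m.centralBinom)) := by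
            gcongr
            linarith
        _ = 2 * ((m : ℝ) + 1) ^ (n + 1) * (d ^ 2) ^ m * m.centralBinom := by ring
        _ ≤ K * m.centralBinom := by gcongr
    calc _ = (a ^ 2) ^ m * (m ! * m !) * ((d ^ 2) ^ m * 4 ^ m * n.multichoose m) := by ring
      _ ≤ (a ^ 2) ^ m * (m ! * m !) * (K * m.centralBinom) := by gcongr
      _ = _ := by ring
  refine le_trans ?_ hc
  rw [Real.cosh_eq]
  have := Real.exp_pos (-(2 * d * a))
  rw [one_div, mul_inv, mul_comm (2 : ℝ)⁻¹, mul_assoc]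
  gcongr
  linarith

end besselPhi

end BlockFading
end

/-! ### The uniform law on the sphere and its exponential mean -/

noncomputable section
namespace BlockFading

open scoped ENNReal Nat
open Filter Topology
open WithLp (toLp ofLp)

/-- The real part of the Hermitian inner product on `ℂⁿ`. -/
def reInner {n : ℕ} (y x : Fin n → ℂ) : ℝ := (∑ i, (starRingEnd ℂ) (y i) * x i).re

section reInner
variable {n : ℕ}

theorem reInner_eq_inner (y x : Fin n → ℂ) : reInner y x = (inner ℂ (toLp 2 y) (toLp 2 x)).re := by
  rw [reInner, PiLp.inner_apply]
  congr 1
  refine Finset.sum_congr rfl fun i _ => ?_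
  simp [mul_comm]

theorem reInner_unitaryAct (U : EuclideanSpace ℂ (Fin n) ≃ₗᵢ[ℂ] EuclideanSpace ℂ (Fin n))
    (y x : Fin n → ℂ) : reInner (unitaryAct U y) (unitaryAct U x) = reInner y x := by
  rw [reInner_eq_inner, reInner_eq_inner]
  exact congrArg Complex.re (U.inner_map_map _ _)

theorem measurable_reInner : Measurable fun p : (Fin n → ℂ) × (Fin n → ℂ) => reInner p.1 p.2 := by
  have : Continuous fun p : (Fin n → ℂ) × (Fin n → ℂ) => reInner p.1 p.2 := by
    unfold reInner
    fun_prop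
  exact this.measurable

theorem reInner_comm (y x : Fin n → ℂ) : reInner y x = reInner x y := by
  rw [reInner, reInner, ← Complex.conj_re, map_sum]
  simp [mul_comm]

theorem l2norm_sub_sq (y x : Fin n → ℂ) :
    l2norm (y - x) ^ 2 = l2norm y ^ 2 - 2 * reInner y x + l2norm x ^ 2 := by
  rw [l2norm_sq, l2norm_sq, l2norm_sq, reInner, Complex.re_sum, Finset.mul_sum,
    ← Finset.sum_sub_distrib, ← Finset.sum_add_distrib]
  refine Finset.sum_congr rfl fun i _ => ?_
  simp only [Pi.sub_apply, Complex.sq_norm, Complex.normSq_apply, Complex.sub_re, Complex.sub_im,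
    Complex.mul_re, Complex.conj_re, Complex.conj_im]
  ring

theorem l2norm_smul (c : ℂ) (x : Fin n → ℂ) : l2norm (c • x) = ‖c‖ * l2norm x := by
  rw [l2norm_eq_norm, l2norm_eq_norm, WithLp.toLp_smul, norm_smul]

theorem reInner_smul_smul (r : ℝ) (y x : Fin n → ℂ) :
    reInner y ((r : ℂ) • x) = r * reInner y x := by
  simp only [reInner, Pi.smul_apply, smul_eq_mul, mul_left_comm _ (r : ℂ), ← Finset.mul_sum,
    Complex.re_ofReal_mul]

theorem reInner_firstCoord (hn : 0 < n) (a : ℂ) (x : Fin n → ℂ) :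
    reInner (firstCoord a) x = ((starRingEnd ℂ) a * x ⟨0, hn⟩).re := by
  rw [reInner, Finset.sum_eq_single ⟨0, hn⟩]
  · simp [firstCoord]
  · intro i _ hi
    have : (i : ℕ) ≠ 0 := fun h => hi (Fin.ext h)
    simp [firstCoord, this]
  · simp

theorem l2norm_firstCoord (hn : 0 < n) (a : ℂ) : l2norm (firstCoord a : Fin n → ℂ) = ‖a‖ := by
  rw [l2norm, Finset.sum_eq_single ⟨0, hn⟩]
  · simp [firstCoord]
  · intro i _ hi
    have : (i : ℕ) ≠ 0 := fun h => hi (Fin.ext h)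
    simp [firstCoord, this]
  · simp

end reInner

theorem cgaussZero_one_absolutelyContinuous : cgaussZero 1 ≪ (volume : Measure ℂ) := by
  rw [cgaussZero_one_eq_withDensity]
  exact withDensity_absolutelyContinuous _ _

theorem noiseLaw_map_eval {n : ℕ} (i : Fin n) :
    (noiseLaw n).map (fun w => w i) = cgaussZero 1 := by
  rw [← cgauss_zero]
  exact (measurePreserving_eval (fun _ : Fin n => cgauss 0 1) i).map_eq

theorem ae_noiseLaw_eval_notMem {n : ℕ} (i : Fin n) {S : Set ℂ} (hS : volume S = 0) :
    ∀ᵐ w ∂(noiseLaw n), w i ∉ S := by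
  have h : ∀ᵐ z ∂((noiseLaw n).map (fun w => w i)), z ∉ S := by
    rw [noiseLaw_map_eval]
    exact measure_eq_zero_iff_ae_notMem.1 (cgaussZero_one_absolutelyContinuous hS)
  exact ae_of_ae_map (measurable_pi_apply i).aemeasurable h

/-- The uniform law on the sphere of radius `R` in `ℂⁿ`: the law of `R g / ‖g‖` for a Gaussian
vector `g`. -/
def shellLaw (n : ℕ) (R : ℝ) : Measure (Fin n → ℂ) :=
  (noiseLaw n).map (fun g => ((R / l2norm g : ℝ) : ℂ) • g)

section shellLaw
variable {n : ℕ}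

theorem measurable_shellMap (R : ℝ) :
    Measurable (fun g : Fin n → ℂ => ((R / l2norm g : ℝ) : ℂ) • g) := by
  have := measurable_l2norm (n := n)
  fun_prop

instance (R : ℝ) : IsProbabilityMeasure (shellLaw n R) :=
  Measure.isProbabilityMeasure_map (measurable_shellMap R).aemeasurable

theorem ae_l2norm_shellLaw (hn : 0 < n) {R : ℝ} (hR : 0 ≤ R) :
    ∀ᵐ x ∂(shellLaw n R), l2norm x = R := by
  rw [shellLaw, ae_map_iff (measurable_shellMap R).aemeasurable
    (measurableSet_eq_fun measurable_l2norm measurable_const)]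
  filter_upwards [ae_noiseLaw_eval_notMem (⟨0, hn⟩ : Fin n) (measure_singleton (0 : ℂ))] with g hg
  have h0 : l2norm g ≠ 0 := by
    rw [l2norm_eq_norm, norm_ne_zero_iff]
    intro h
    apply hg
    have := congrFun (congrArg ofLp h) ⟨0, hn⟩
    simpa using this
  have := l2norm_nonneg g
  rw [l2norm_smul, Complex.norm_real, Real.norm_of_nonneg (by positivity)]
  field_simp

theorem shellLaw_map_unitaryAct (R : ℝ)
    (U : EuclideanSpace ℂ (Fin n) ≃ₗᵢ[ℂ] EuclideanSpace ℂ (Fin n)) :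
    (shellLaw n R).map (unitaryAct U) = shellLaw n R := by
  rw [shellLaw, Measure.map_map (measurable_unitaryAct U) (measurable_shellMap R)]
  conv_rhs => rw [← noiseLaw_map_unitaryAct U]
  rw [Measure.map_map (measurable_shellMap R) (measurable_unitaryAct U)]
  congr 1
  funext g
  simp [unitaryAct_smul, l2norm_unitaryAct]

theorem shellLaw_eq_map (R : ℝ) :
    shellLaw n R = (shellLaw n 1).map (fun u => (R : ℂ) • u) := by
  rw [shellLaw, shellLaw, Measure.map_map (by fun_prop) (measurable_shellMap 1)]
  congr 1
  funext g
  simp only [Function.comp_apply, smul_smul]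
  push_cast
  ring_nf

/-- Rotating y onto the first axis leaves one unknown constant, independent of y. -/
theorem lintegral_reInner_pow_shellLaw_eq (hn : 0 < n) (m : ℕ) (y : Fin n → ℂ) :
    ∫⁻ u, ENNReal.ofReal (reInner y u ^ 2) ^ m ∂(shellLaw n 1) =
      ENNReal.ofReal (l2norm y ^ 2) ^ m *
        ∫⁻ u, ENNReal.ofReal ((u ⟨0, hn⟩).re ^ 2) ^ m ∂(shellLaw n 1) := by
  obtain ⟨U, hU⟩ := exists_unitaryAct_eq_firstCoord y
  rw [← lintegral_const_mul _ (by fun_prop)]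
  conv_rhs => rw [← shellLaw_map_unitaryAct 1 U, lintegral_map (by fun_prop) (measurable_unitaryAct U)]
  refine lintegral_congr fun u => ?_
  rw [← reInner_unitaryAct U, hU, reInner_firstCoord hn, ← mul_pow,
    ← ENNReal.ofReal_mul (by positivity), Complex.conj_ofReal, Complex.re_ofReal_mul, mul_pow]

theorem lintegral_reInner_pow_noiseLaw (m : ℕ) (u : Fin n → ℂ) (hu : l2norm u = 1) :
    ∫⁻ g, ENNReal.ofReal (reInner g u ^ 2) ^ m ∂(noiseLaw n) =
      ENNReal.ofReal ((2 * m - 1 : ℕ)‼ / 2 ^ m) := by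
  have h := noiseLaw_map_linear (fun i => (starRingEnd ℂ) (u i))
  have h1 : l2norm (fun i => (starRingEnd ℂ) (u i)) = 1 := by
    rw [← hu]
    simp [l2norm]
  rw [h1, one_pow] at h
  rw [← lintegral_re_sq_pow_cgaussZero, ← h, lintegral_map (by fun_prop) (by fun_prop)]
  simp_rw [reInner_comm _ u]
  rfl

/-- The constant `K` is found by integrating Re⟨g, u⟩^{2m} over a Gaussian g and a spherical u in
both orders. One order gives E‖g‖^{2m} · K, the other a moment of N(0, 1/2). No surface measure is
needed. -/
theorem lintegral_reInner_pow_shellLaw (hn : 0 < n) (m : ℕ) (y : Fin n → ℂ) :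
    ∫⁻ u, ENNReal.ofReal (reInner y u ^ 2) ^ m ∂(shellLaw n 1) =
      ENNReal.ofReal ((l2norm y ^ 2) ^ m * ((2 * m - 1 : ℕ)‼ / 2 ^ m) / n.ascFactorial m) := by
  have hpos : (0 : ℝ) < n.ascFactorial m := by
    exact_mod_cast one_le_ascFactorial hn m
  set K := ∫⁻ u, ENNReal.ofReal ((u ⟨0, hn⟩).re ^ 2) ^ m ∂(shellLaw n 1) with hK
  have hsq : Measurable fun p : (Fin n → ℂ) × (Fin n → ℂ) =>
      ENNReal.ofReal (reInner p.1 p.2 ^ 2) ^ m := by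
    have := measurable_reInner (n := n)
    fun_prop
  have h1 : ∫⁻ g, ∫⁻ u, ENNReal.ofReal (reInner g u ^ 2) ^ m ∂(shellLaw n 1) ∂(noiseLaw n) =
      n.ascFactorial m * K := by
    simp_rw [lintegral_reInner_pow_shellLaw_eq hn m]
    have := measurable_l2norm (n := n)
    rw [lintegral_mul_const _ (by fun_prop), lintegral_l2norm_sq_pow]
  have h2 : ∫⁻ g, ∫⁻ u, ENNReal.ofReal (reInner g u ^ 2) ^ m ∂(shellLaw n 1) ∂(noiseLaw n) =
      ENNReal.ofReal ((2 * m - 1 : ℕ)‼ / 2 ^ m) := by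
    rw [lintegral_lintegral_swap hsq.aemeasurable]
    have : ∀ᵐ u ∂(shellLaw n 1), ∫⁻ g, ENNReal.ofReal (reInner g u ^ 2) ^ m ∂(noiseLaw n) =
        ENNReal.ofReal ((2 * m - 1 : ℕ)‼ / 2 ^ m) := by
      filter_upwards [ae_l2norm_shellLaw hn zero_le_one] with u hu
      exact lintegral_reInner_pow_noiseLaw m u hu
    rw [lintegral_congr_ae this]
    simp
  have h3 : K = ENNReal.ofReal (((2 * m - 1 : ℕ)‼ / 2 ^ m) / n.ascFactorial m) := by
    rw [h1] at h2
    rw [ENNReal.ofReal_div_of_pos hpos, ← h2, ENNReal.ofReal_natCast,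
      ENNReal.mul_div_right_comm, ENNReal.div_self, one_mul]
    · exact_mod_cast hpos.ne'
    · exact ENNReal.natCast_ne_top _
  rw [lintegral_reInner_pow_shellLaw_eq hn m, ← hK, h3, ← ENNReal.ofReal_pow (by positivity),
    ← ENNReal.ofReal_mul (by positivity), mul_div_assoc]

theorem shellLaw_map_neg (R : ℝ) : (shellLaw n R).map (fun u => -u) = shellLaw n R := by
  have h := shellLaw_map_unitaryAct (n := n) R (LinearIsometryEquiv.neg ℂ)
  have e : unitaryAct (LinearIsometryEquiv.neg ℂ) = fun u : Fin n → ℂ => -u := by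
    funext u
    simp [unitaryAct]
  rwa [e] at h

/-- The symmetry u ↦ -u turns exp into cosh, whose series has nonnegative terms and so integrates
term by term. The even moments and (2m)! = 2^m m! (2m - 1)‼ then produce the series of `besselPhi`.
-/
theorem lintegral_exp_reInner_unitShell (hn : 0 < n) (y : Fin n → ℂ) :
    ∫⁻ u, ENNReal.ofReal (Real.exp (2 * reInner y u)) ∂(shellLaw n 1) =
      ENNReal.ofReal (besselPhi n (l2norm y)) := by
  have hmy : Measurable (fun u : Fin n → ℂ => reInner y u) :=
    measurable_reInner.comp (measurable_const.prodMk measurable_id)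
  have hneg : ∫⁻ u, ENNReal.ofReal (Real.exp (2 * reInner y u)) ∂(shellLaw n 1) =
      ∫⁻ u, ENNReal.ofReal (Real.exp (-(2 * reInner y u))) ∂(shellLaw n 1) := by
    conv_lhs => rw [← shellLaw_map_neg, lintegral_map (by fun_prop) (by fun_prop)]
    refine lintegral_congr fun u => ?_
    congr 2
    simp [reInner]
  have hcosh : ∫⁻ u, ENNReal.ofReal (Real.exp (2 * reInner y u)) ∂(shellLaw n 1) =
      ∫⁻ u, ENNReal.ofReal (Real.cosh (2 * reInner y u)) ∂(shellLaw n 1) := by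
    have e : ∀ u : Fin n → ℂ, ENNReal.ofReal (Real.cosh (2 * reInner y u)) =
        2⁻¹ * (ENNReal.ofReal (Real.exp (2 * reInner y u)) +
          ENNReal.ofReal (Real.exp (-(2 * reInner y u)))) := by
      intro u
      rw [Real.cosh_eq, ← ENNReal.ofReal_add (by positivity) (by positivity),
        ENNReal.ofReal_div_of_pos two_pos, div_eq_mul_inv, mul_comm]
      simp
    simp_rw [e]
    rw [lintegral_const_mul _ (by fun_prop), lintegral_add_left (by fun_prop), ← hneg, ← two_mul,
      ← mul_assoc, ENNReal.inv_mul_cancel two_ne_zero ENNReal.ofNat_ne_top, one_mul]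
  have hser : ∀ u : Fin n → ℂ, ENNReal.ofReal (Real.cosh (2 * reInner y u)) =
      ∑' m : ℕ, ENNReal.ofReal (4 ^ m / (2 * m)!) * ENNReal.ofReal (reInner y u ^ 2) ^ m := by
    intro u
    rw [Real.cosh_eq_tsum, ENNReal.ofReal_tsum_of_nonneg]
    · refine tsum_congr fun m => ?_
      rw [← ENNReal.ofReal_pow (by positivity), ← ENNReal.ofReal_mul (by positivity)]
      congr 1
      rw [pow_mul, mul_pow, mul_pow]
      ring
    · intro m
      rw [pow_mul]
      positivity
    · exact (Real.hasSum_cosh _).summable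
  rw [hcosh]
  simp_rw [hser]
  rw [lintegral_tsum (fun m => by fun_prop), besselPhi, ENNReal.ofReal_tsum_of_nonneg
    (fun m => by positivity) (summable_besselPhi hn _)]
  refine tsum_congr fun m => ?_
  rw [lintegral_const_mul _ (by fun_prop), lintegral_reInner_pow_shellLaw hn,
    ← ENNReal.ofReal_mul (by positivity)]
  congr 1
  have hf : ((2 * m)! : ℝ) = 2 ^ m * m ! * (2 * m - 1 : ℕ)‼ := by
    rcases Nat.eq_zero_or_pos m with rfl | hm
    · simp
    · obtain ⟨k, hk⟩ : ∃ k, 2 * m = k + 1 := ⟨2 * m - 1, by omega⟩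
      have h1 := Nat.factorial_eq_mul_doubleFactorial k
      rw [← hk, Nat.doubleFactorial_two_mul] at h1
      rw [show 2 * m - 1 = k by omega, h1]
      push_cast
      ring
  have hd : ((2 * m - 1 : ℕ)‼ : ℝ) ≠ 0 := by
    exact_mod_cast (Nat.doubleFactorial_pos _).ne'
  have hpos : (n.ascFactorial m : ℝ) ≠ 0 := by
    have := one_le_ascFactorial hn m
    positivity
  rw [hf, show (4 : ℝ) = 2 * 2 by norm_num, mul_pow]
  field_simp

theorem lintegral_exp_reInner_shellLaw (hn : 0 < n) {R : ℝ} (hR : 0 ≤ R) (y : Fin n → ℂ) :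
    ∫⁻ x, ENNReal.ofReal (Real.exp (2 * reInner y x)) ∂(shellLaw n R) =
      ENNReal.ofReal (besselPhi n (R * l2norm y)) := by
  have hmy : Measurable (fun u : Fin n → ℂ => reInner y u) :=
    measurable_reInner.comp (measurable_const.prodMk measurable_id)
  have h := lintegral_exp_reInner_unitShell hn ((R : ℂ) • y)
  rw [l2norm_smul, Complex.norm_real, Real.norm_of_nonneg hR] at h
  rw [← h, shellLaw_eq_map, lintegral_map (by fun_prop) (by fun_prop)]
  refine lintegral_congr fun u => ?_
  rw [reInner_smul_smul, reInner_comm ((R : ℂ) • y) u, reInner_smul_smul, reInner_comm u]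

end shellLaw

end BlockFading
end

/-! ### Information density, and attainment of the minimum over `s` -/

noncomputable section
namespace BlockFading

open scoped ENNReal Nat
open Filter Topology

/-- The generalized information density of one block, for the scaled nearest-neighbour metric with
estimate `e`, input `x` on the sphere of radius `R`, and output `y`. -/
def infoDensity {n : ℕ} (R s : ℝ) (e : ℂ) (x y : Fin n → ℂ) : ℝ :=
  2 * s * reInner y (e • x) - Real.log (besselPhi n (s * ‖e‖ * l2norm y * R))

/-- The value of `tStat` when the argument of its last two logarithms vanishes. -/
def degenerateConst (n : ℕ) : ℝ := -Real.log (Real.Gamma n) - Real.log (besselI (n - 1) 0)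

/-- The difference between `tStat` and the information density, for `s > 0`. -/
def degenerateTerm {n : ℕ} (R : ℝ) (e : ℂ) (y : Fin n → ℂ) : ℝ :=
  if ‖e‖ * l2norm y * R = 0 then degenerateConst n else 0

section tStat
variable {n : ℕ}

theorem degenerateConst_nonpos (hn : 0 < n) : degenerateConst n ≤ 0 := by
  have h := besselI_eq_besselPhi hn 0
  rw [mul_zero, besselPhi_zero, mul_one] at h
  obtain ⟨k, rfl⟩ : ∃ k, n = k + 1 := ⟨n - 1, by omega⟩
  rw [degenerateConst, h, Nat.add_sub_cancel]
  push_cast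
  rw [Real.Gamma_nat_eq_factorial]
  -- For n = 1 both logarithms vanish. For n ≥ 2 the Bessel value is 0, so `Real.log 0 = 0` leaves
  -- -log (n - 1)! ≤ 0.
  rcases Nat.eq_zero_or_pos k with rfl | hk
  · simp
  · have h1 : (1 : ℝ) ≤ (k ! : ℕ) := by exact_mod_cast Nat.succ_le_of_lt k.factorial_pos
    have := Real.log_nonneg h1
    simp [hk.ne', this]

theorem degenerateTerm_nonpos (hn : 0 < n) (R : ℝ) (e : ℂ) (y : Fin n → ℂ) :
    degenerateTerm R e y ≤ 0 := by
  rw [degenerateTerm]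
  split_ifs
  · exact degenerateConst_nonpos hn
  · exact le_rfl

theorem wTilde_eq (ρd : ℝ) (h e : ℂ) (w : Fin n → ℂ) :
    wTilde ρd h e w = wBar ρd h w - e • firstCoord (Real.sqrt (n * ρd) : ℂ) := by
  funext i
  simp only [wTilde, wBar, firstCoord, Pi.add_apply, Pi.sub_apply, Pi.smul_apply, smul_eq_mul]
  split_ifs <;> ring

/-- `wTilde` is `wBar` minus e times the rotated input, so expanding the square leaves only the
cross term. -/
theorem tStat_linear_part (hn : 0 < n) {ρd : ℝ} (hρ : 0 ≤ ρd) (s : ℝ) (h e : ℂ) (w : Fin n → ℂ) :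
    s * (l2norm (wBar ρd h w) ^ 2 - l2norm (wTilde ρd h e w) ^ 2) + s * n * ρd * ‖e‖ ^ 2 =
      2 * s * reInner (wBar ρd h w) (e • firstCoord (Real.sqrt (n * ρd) : ℂ)) := by
  have hR : Real.sqrt (n * ρd) ^ 2 = n * ρd := Real.sq_sqrt (by positivity)
  rw [wTilde_eq, l2norm_sub_sq, l2norm_smul, l2norm_firstCoord hn, Complex.norm_real,
    Real.norm_of_nonneg (Real.sqrt_nonneg _), mul_pow, hR]
  ring

theorem tStat_eq_infoDensity_add (hn : 0 < n) {ρd : ℝ} (hρ : 0 ≤ ρd) {s : ℝ} (hs : 0 < s)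
    (h e : ℂ) (w : Fin n → ℂ) :
    tStat ρd s h e w =
      infoDensity (Real.sqrt (n * ρd)) s e (firstCoord (Real.sqrt (n * ρd) : ℂ)) (wBar ρd h w) +
        degenerateTerm (Real.sqrt (n * ρd)) e (wBar ρd h w) := by
  rw [tStat, tStat_linear_part hn hρ, infoDensity, degenerateTerm]
  set R := Real.sqrt (n * ρd)
  set y := wBar ρd h w
  have ea : 2 * s * ‖e‖ * l2norm y * R = 2 * (s * ‖e‖ * l2norm y * R) := by ring
  rw [ea]
  set a := s * ‖e‖ * l2norm y * R with ha
  have ha' : a = s * (‖e‖ * l2norm y * R) := by rw [ha]; ring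
  split_ifs with h0
  · rw [h0, mul_zero] at ha'
    rw [ha', besselPhi_zero, degenerateConst]
    simp only [Real.log_zero, Real.log_one, mul_zero]
    ring
  · have ha0 : a ≠ 0 := by
      rw [ha']
      exact mul_ne_zero hs.ne' h0
    have hG : Real.Gamma n ≠ 0 := (Real.Gamma_pos_of_pos (by exact_mod_cast hn)).ne'
    have hP : besselPhi n a ≠ 0 := by
      have := one_le_besselPhi hn a
      positivity
    rw [besselI_eq_besselPhi hn, Real.log_mul (div_ne_zero (pow_ne_zero _ ha0) hG) hP,
      Real.log_div (pow_ne_zero _ ha0) hG, Real.log_pow, Nat.cast_sub hn, Nat.cast_one]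
    ring

theorem tStat_zero (hn : 0 < n) {ρd : ℝ} (hρ : 0 ≤ ρd) (h e : ℂ) (w : Fin n → ℂ) :
    tStat ρd 0 h e w = degenerateConst n := by
  rw [tStat, tStat_linear_part hn hρ, degenerateConst]
  simp

theorem measurable_wBar (ρd : ℝ) :
    Measurable fun p : ℂ × (Fin n → ℂ) => wBar ρd p.1 p.2 := by
  refine measurable_pi_lambda _ fun i => ?_
  simp only [wBar, firstCoord, Pi.add_apply]
  split_ifs <;> fun_prop

theorem measurable_infoDensity (hn : 0 < n) (R s : ℝ) :
    Measurable fun p : ℂ × (Fin n → ℂ) × (Fin n → ℂ) => infoDensity R s p.1 p.2.1 p.2.2 := by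
  have h1 := measurable_reInner (n := n)
  have h2 := (continuous_besselPhi hn).measurable
  have h3 := measurable_l2norm (n := n)
  have h4 : Measurable fun p : ℂ × (Fin n → ℂ) × (Fin n → ℂ) => reInner p.2.2 (p.1 • p.2.1) :=
    h1.comp (f := fun p : ℂ × (Fin n → ℂ) × (Fin n → ℂ) => (p.2.2, p.1 • p.2.1)) (by fun_prop)
  have h5 : Measurable fun p : ℂ × (Fin n → ℂ) × (Fin n → ℂ) =>
      besselPhi n (s * ‖p.1‖ * l2norm p.2.2 * R) :=
    h2.comp (by fun_prop)
  unfold infoDensity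
  fun_prop

theorem measurable_degenerateTerm (R : ℝ) :
    Measurable fun p : ℂ × (Fin n → ℂ) => degenerateTerm R p.1 p.2 := by
  have h3 := measurable_l2norm (n := n)
  refine Measurable.ite (measurableSet_eq_fun (by fun_prop) measurable_const)
    measurable_const measurable_const

theorem continuous_infoDensity (hn : 0 < n) (R : ℝ) (e : ℂ) (x y : Fin n → ℂ) :
    Continuous fun s => infoDensity R s e x y := by
  have h2 := continuous_besselPhi hn
  have h3 : ∀ s, besselPhi n (s * ‖e‖ * l2norm y * R) ≠ 0 := fun s => by
    have := one_le_besselPhi hn (s * ‖e‖ * l2norm y * R)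
    positivity
  have h4 : Continuous fun s => besselPhi n (s * ‖e‖ * l2norm y * R) :=
    h2.comp (by fun_prop)
  unfold infoDensity
  exact (by fun_prop : Continuous fun s : ℝ => 2 * s * reInner y (e • x)).sub (h4.log h3)

theorem infoDensity_zero (R : ℝ) (e : ℂ) (x y : Fin n → ℂ) : infoDensity R 0 e x y = 0 := by
  simp [infoDensity, besselPhi_zero]

/-- The logarithm of the Bessel factor at sa is at least 2dsa up to a constant, for every d < 1, and
d can be taken so close to 1 that 2da still exceeds c. -/
theorem eventually_mul_sub_log_besselPhi_nonpos (hn : 0 < n) {a c : ℝ} (ha : 0 ≤ a)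
    (hc : c < 2 * a) : ∀ᶠ s in atTop, s * c - Real.log (besselPhi n (s * a)) ≤ 0 := by
  obtain ⟨d, hd0, hd1, hd⟩ : ∃ d : ℝ, 0 < d ∧ d < 1 ∧ c < 2 * d * a := by
    -- The 1/2 keeps d positive, and a + 1 in place of a allows a = 0.
    refine ⟨1 - min (1 / 2) ((2 * a - c) / (4 * (a + 1))), ?_, ?_, ?_⟩
    · have := min_le_left (1 / 2 : ℝ) ((2 * a - c) / (4 * (a + 1)))
      linarith
    · have : 0 < min (1 / 2 : ℝ) ((2 * a - c) / (4 * (a + 1))) :=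
        lt_min (by norm_num) (div_pos (by linarith) (by linarith))
      linarith
    · have h1 := min_le_right (1 / 2 : ℝ) ((2 * a - c) / (4 * (a + 1)))
      have h2 : (2 * a - c) / (4 * (a + 1)) * (4 * (a + 1)) = 2 * a - c :=
        div_mul_cancel₀ _ (by positivity)
      have h3 : 0 < (2 * a - c) / (4 * (a + 1)) := div_pos (by linarith) (by linarith)
      nlinarith
  obtain ⟨C, hC, hCle⟩ := exists_mul_exp_le_besselPhi hn hd0 hd1
  have hlim : Tendsto (fun s : ℝ => s * (2 * d * a - c)) atTop atTop :=
    tendsto_id.atTop_mul_const (by linarith)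
  filter_upwards [hlim.eventually_ge_atTop (-Real.log C)] with s hs
  have h1 := Real.log_le_log (by positivity) (hCle (s * a))
  rw [Real.log_mul hC.ne' (Real.exp_pos _).ne', Real.log_exp] at h1
  nlinarith

/-- A nonzero imaginary part makes Re(conj(e) y₀) < |e|‖y‖ strict, so the linear slope is below the
growth rate of the Bessel term. If e = 0 or R = 0, the density vanishes identically. -/
theorem eventually_infoDensity_nonpos (hn : 0 < n) {R : ℝ} (hR : 0 ≤ R) (e : ℂ) (y : Fin n → ℂ)
    (hy : e = 0 ∨ ((starRingEnd ℂ) e * y ⟨0, hn⟩).im ≠ 0) :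
    ∀ᶠ s in atTop, infoDensity R s e (firstCoord (R : ℂ)) y ≤ 0 := by
  rcases hR.eq_or_lt with rfl | hR
  · refine Eventually.of_forall fun s => ?_
    have : e • (firstCoord ((0 : ℝ) : ℂ) : Fin n → ℂ) = 0 := by
      funext i
      simp [firstCoord]
    rw [infoDensity, this]
    simp [reInner, besselPhi_zero]
  rcases hy with rfl | hy
  · refine Eventually.of_forall fun s => ?_
    simp [infoDensity, reInner, besselPhi_zero]
  set z := (starRingEnd ℂ) e * y ⟨0, hn⟩ with hz
  have h1 : reInner y (e • firstCoord (R : ℂ)) = R * z.re := by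
    have : e • (firstCoord (R : ℂ) : Fin n → ℂ) = firstCoord (e * R) := by
      funext i
      simp [firstCoord]
    rw [this, reInner_comm, reInner_firstCoord hn, hz, ← Complex.re_ofReal_mul, map_mul,
      Complex.conj_ofReal]
    ring_nf
  have h2 : z.re < ‖e‖ * l2norm y := by
    have h3 : |z.re| < ‖z‖ := Complex.abs_re_lt_norm.2 hy
    have h4 : ‖z‖ = ‖e‖ * ‖y ⟨0, hn⟩‖ := by simp [hz]
    have h5 : ‖y ⟨0, hn⟩‖ ≤ l2norm y := by
      rw [l2norm_eq_norm]
      exact PiLp.norm_apply_le (WithLp.toLp 2 y) _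
    calc z.re ≤ |z.re| := le_abs_self _
      _ < ‖e‖ * ‖y ⟨0, hn⟩‖ := h4 ▸ h3
      _ ≤ ‖e‖ * l2norm y := by gcongr
  have h6 := l2norm_nonneg y
  filter_upwards [eventually_mul_sub_log_besselPhi_nonpos hn (a := ‖e‖ * l2norm y * R)
    (c := 2 * (R * z.re)) (by positivity) (by nlinarith)] with s hs
  rw [infoDensity, h1]
  convert hs using 2
  · ring
  · ring_nf

end tStat

theorem volume_im_conj_mul_add_eq_zero {e : ℂ} (he : e ≠ 0) (c : ℂ) :
    volume {z : ℂ | ((starRingEnd ℂ) e * (c + z)).im = 0} = 0 := by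
  let L : ℂ →ₗ[ℝ] ℝ := Complex.imLm ∘ₗ LinearMap.mulLeft ℝ ((starRingEnd ℂ) e)
  have hker : LinearMap.ker L ≠ ⊤ := by
    intro h
    have h1 : e * Complex.I ∈ LinearMap.ker L := h ▸ Submodule.mem_top
    have h2 : ((starRingEnd ℂ) e * (e * Complex.I)).im = 0 := h1
    rw [← mul_assoc, ← Complex.normSq_eq_conj_mul_self, Complex.im_ofReal_mul] at h2
    simp at h2
    exact he h2
  have : {z : ℂ | ((starRingEnd ℂ) e * (c + z)).im = 0} =
      (fun z => c + z) ⁻¹' (LinearMap.ker L : Set ℂ) := rfl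
  rw [this, measure_preimage_add]
  exact Measure.addHaar_submodule _ _ hker

instance (κ : ℝ) (np nd : ℕ) (ρp : ℝ) : IsProbabilityMeasure (blockLaw κ np nd ρp) := by
  unfold blockLaw
  infer_instance

/-- Given the fading and a nonzero estimate, the exceptional first noise coordinates form a real
line in ℂ, which a law with a density does not charge. -/
theorem ae_blockLaw_nondegenerate (κ : ℝ) (np : ℕ) {nd : ℕ} (hnd : 0 < nd) (ρp ρd : ℝ) :
    ∀ᵐ b ∂(blockLaw κ np nd ρp), b.1.2 = 0 ∨
      ((starRingEnd ℂ) b.1.2 * wBar ρd b.1.1 b.2 ⟨0, hnd⟩).im ≠ 0 := by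
  have hw := measurable_wBar (n := nd) ρd
  have hw' : Measurable fun b : (ℂ × ℂ) × (Fin nd → ℂ) => wBar ρd b.1.1 b.2 :=
    hw.comp (f := fun b : (ℂ × ℂ) × (Fin nd → ℂ) => (b.1.1, b.2)) (by fun_prop)
  have hm : MeasurableSet {b : (ℂ × ℂ) × (Fin nd → ℂ) | b.1.2 = 0 ∨
      ((starRingEnd ℂ) b.1.2 * wBar ρd b.1.1 b.2 ⟨0, hnd⟩).im ≠ 0} := by
    refine MeasurableSet.union (measurableSet_eq_fun (by fun_prop) measurable_const)
      (measurableSet_eq_fun ?_ measurable_const).compl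
    have := (measurable_pi_apply (⟨0, hnd⟩ : Fin nd)).comp hw'
    have hc : Measurable fun b : (ℂ × ℂ) × (Fin nd → ℂ) => (starRingEnd ℂ) b.1.2 :=
      Complex.continuous_conj.measurable.comp (by fun_prop)
    exact Complex.measurable_im.comp (hc.mul this)
  rw [blockLaw]
  refine (Measure.ae_prod_mem_iff_ae_ae_mem hm).2 (ae_of_all _ fun p => ?_)
  by_cases hp : p.2 = 0
  · exact ae_of_all _ fun w => Or.inl hp
  · filter_upwards [ae_noiseLaw_eval_notMem (⟨0, hnd⟩ : Fin nd)
      (volume_im_conj_mul_add_eq_zero hp (p.1 * (Real.sqrt (nd * ρd) : ℂ)))] with w hw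
    refine Or.inr fun h => hw ?_
    simpa [wBar, firstCoord] using h

section rcusTerm

theorem rcusTerm_one (t : ℝ) : rcusTerm 1 t = 0 := by simp [rcusTerm]

theorem rcusTerm_nonneg (M : ℕ) (t : ℝ) : 0 ≤ rcusTerm M t := by
  rw [rcusTerm]
  split_ifs
  · exact le_rfl
  · positivity

theorem rcusTerm_le_one (M : ℕ) (t : ℝ) : rcusTerm M t ≤ 1 := by
  rw [rcusTerm]
  split_ifs
  · exact zero_le_one
  · rw [Real.exp_le_one_iff]
    have := le_max_left 0 (t - Real.log ((M : ℝ) - 1))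
    linarith

theorem continuous_rcusTerm (M : ℕ) : Continuous (rcusTerm M) := by
  unfold rcusTerm
  split_ifs <;> fun_prop

theorem antitone_rcusTerm (M : ℕ) : Antitone (rcusTerm M) := by
  intro t u h
  rw [rcusTerm, rcusTerm]
  split_ifs
  · exact le_rfl
  · gcongr

theorem rcusTerm_of_nonpos {M : ℕ} (hM : 2 ≤ M) {t : ℝ} (ht : t ≤ 0) : rcusTerm M t = 1 := by
  have h1 : (1 : ℝ) ≤ (M : ℝ) - 1 := by
    have : (2 : ℝ) ≤ M := by exact_mod_cast hM
    linarith
  have h2 := Real.log_nonneg h1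
  rw [rcusTerm, if_neg (by omega), max_eq_left (by linarith)]
  simp

end rcusTerm

section rcusAt
variable (κ : ℝ) {ℓ np nd : ℕ} (ρp : ℝ) {ρd : ℝ} (M : ℕ)

/-- The statistic of one block, extended continuously in `s` to `s = 0`. -/
def contStat {nd : ℕ} (ρd s : ℝ) (b : (ℂ × ℂ) × (Fin nd → ℂ)) : ℝ :=
  infoDensity (Real.sqrt (nd * ρd)) s b.1.2 (firstCoord (Real.sqrt (nd * ρd) : ℂ))
      (wBar ρd b.1.1 b.2) +
    degenerateTerm (Real.sqrt (nd * ρd)) b.1.2 (wBar ρd b.1.1 b.2)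

theorem measurable_contStat (hnd : 0 < nd) (ρd s : ℝ) : Measurable (contStat (nd := nd) ρd s) := by
  have hw' : Measurable fun b : (ℂ × ℂ) × (Fin nd → ℂ) => wBar ρd b.1.1 b.2 :=
    (measurable_wBar ρd).comp (f := fun b : (ℂ × ℂ) × (Fin nd → ℂ) => (b.1.1, b.2)) (by fun_prop)
  refine Measurable.add ?_ ?_
  · exact (measurable_infoDensity hnd (Real.sqrt (nd * ρd)) s).comp
      (f := fun b : (ℂ × ℂ) × (Fin nd → ℂ) =>
        (b.1.2, firstCoord (Real.sqrt (nd * ρd) : ℂ), wBar ρd b.1.1 b.2)) (by fun_prop)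
  · exact (measurable_degenerateTerm (Real.sqrt (nd * ρd))).comp
      (f := fun b : (ℂ × ℂ) × (Fin nd → ℂ) => (b.1.2, wBar ρd b.1.1 b.2)) (by fun_prop)

/-- The continuous extension of `rcusAt` to all real `s`. -/
def rcusExt (κ : ℝ) (ℓ np nd : ℕ) (ρp ρd : ℝ) (M : ℕ) (s : ℝ) : ℝ :=
  ∫ b, rcusTerm M (∑ k, contStat ρd s (b k)) ∂(Measure.pi (fun _ : Fin ℓ => blockLaw κ np nd ρp))

theorem measurable_rcusTerm_contStat (hnd : 0 < nd) (ρd s : ℝ) :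
    Measurable fun b : Fin ℓ → (ℂ × ℂ) × (Fin nd → ℂ) =>
      rcusTerm M (∑ k, contStat ρd s (b k)) := by
  have := measurable_contStat hnd ρd s
  exact (continuous_rcusTerm M).measurable.comp (by fun_prop)

theorem norm_rcusTerm_le_one (t : ℝ) : ‖rcusTerm M t‖ ≤ 1 := by
  rw [Real.norm_of_nonneg (rcusTerm_nonneg M t)]
  exact rcusTerm_le_one M t

theorem continuous_rcusExt (hnd : 0 < nd) : Continuous (rcusExt κ ℓ np nd ρp ρd M) := by
  refine continuous_of_dominated (bound := fun _ => 1)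
    (fun s => (measurable_rcusTerm_contStat M hnd ρd s).aestronglyMeasurable)
    (fun s => ae_of_all _ fun b => norm_rcusTerm_le_one M _) (integrable_const _)
    (ae_of_all _ fun b => (continuous_rcusTerm M).comp (continuous_finsetSum _ fun k _ => ?_))
  exact (continuous_infoDensity hnd _ _ _ _).add continuous_const

theorem rcusAt_eq_rcusExt (hnd : 0 < nd) (hρd : 0 ≤ ρd) {s : ℝ} (hs : 0 < s) :
    rcusAt κ ℓ np nd ρp ρd M s = rcusExt κ ℓ np nd ρp ρd M s := by
  simp only [rcusAt, rcusExt, contStat, tStat_eq_infoDensity_add hnd hρd hs]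

theorem rcusExt_zero (hnd : 0 < nd) (hM : 2 ≤ M) : rcusExt κ ℓ np nd ρp ρd M 0 = 1 := by
  have : ∀ b : Fin ℓ → (ℂ × ℂ) × (Fin nd → ℂ), rcusTerm M (∑ k, contStat ρd 0 (b k)) = 1 := by
    refine fun b => rcusTerm_of_nonpos hM (Finset.sum_nonpos fun k _ => ?_)
    rw [contStat, infoDensity_zero, zero_add]
    exact degenerateTerm_nonpos hnd _ _ _
  simp [rcusExt, this]

theorem rcusAt_zero (hnd : 0 < nd) (hρd : 0 ≤ ρd) (hM : 2 ≤ M) :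
    rcusAt κ ℓ np nd ρp ρd M 0 = 1 := by
  have : ∀ b : Fin ℓ → (ℂ × ℂ) × (Fin nd → ℂ),
      rcusTerm M (∑ k, tStat ρd 0 (b k).1.1 (b k).1.2 (b k).2) = 1 := by
    refine fun b => rcusTerm_of_nonpos hM (Finset.sum_nonpos fun k _ => ?_)
    rw [tStat_zero hnd hρd]
    exact degenerateConst_nonpos hnd
  simp [rcusAt, this]

theorem tendsto_rcusExt_atTop (hnd : 0 < nd) (hM : 2 ≤ M) :
    Tendsto (rcusExt κ ℓ np nd ρp ρd M) atTop (𝓝 1) := by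
  have hae : ∀ᵐ b ∂(Measure.pi (fun _ : Fin ℓ => blockLaw κ np nd ρp)), ∀ k : Fin ℓ,
      (b k).1.2 = 0 ∨
        ((starRingEnd ℂ) (b k).1.2 * wBar ρd (b k).1.1 (b k).2 ⟨0, hnd⟩).im ≠ 0 := by
    rw [ae_all_iff]
    intro k
    exact (measurePreserving_eval (fun _ : Fin ℓ => blockLaw κ np nd ρp)
      k).quasiMeasurePreserving.ae (ae_blockLaw_nondegenerate κ np hnd ρp ρd)
  have h1 : (1 : ℝ) = ∫ _, (1 : ℝ) ∂(Measure.pi (fun _ : Fin ℓ => blockLaw κ np nd ρp)) := by simp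
  rw [h1]
  refine tendsto_integral_filter_of_dominated_convergence (fun _ => 1)
    (Eventually.of_forall fun s => (measurable_rcusTerm_contStat M hnd ρd s).aestronglyMeasurable)
    (Eventually.of_forall fun s => ae_of_all _ fun b => norm_rcusTerm_le_one M _)
    (integrable_const _) ?_
  filter_upwards [hae] with b hb
  refine tendsto_const_nhds.congr' ?_
  filter_upwards [eventually_all.2 fun k => eventually_infoDensity_nonpos hnd
    (Real.sqrt_nonneg (nd * ρd)) _ _ (hb k)] with s hs
  refine (rcusTerm_of_nonpos hM (Finset.sum_nonpos fun k _ => ?_)).symm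
  exact add_nonpos (hs k) (degenerateTerm_nonpos hnd _ _ _)

theorem exists_isMinOn_rcusAt (hnd : 0 < nd) (hρd : 0 ≤ ρd) (hM : 1 ≤ M) :
    ∃ s ∈ Set.Ici (0 : ℝ), IsMinOn (rcusAt κ ℓ np nd ρp ρd M) (Set.Ici 0) s := by
  rcases hM.eq_or_lt with rfl | hM
  · exact ⟨0, Set.self_mem_Ici, fun s _ => by simp [rcusAt, rcusTerm_one]⟩
  -- At s = 0 the convention `Real.log 0 = 0` can make the two integrands' statistics differ. Both
  -- are nonpositive, and log (M - 1) ≥ 0, so both sides equal 1.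
  have heq : Set.EqOn (rcusAt κ ℓ np nd ρp ρd M) (rcusExt κ ℓ np nd ρp ρd M) (Set.Ici 0) := by
    intro s hs
    rcases (show (0 : ℝ) ≤ s from hs).eq_or_lt with rfl | hs
    · rw [rcusAt_zero κ ρp M hnd hρd hM, rcusExt_zero κ ρp M hnd hM]
    · exact rcusAt_eq_rcusExt κ ρp M hnd hρd hs
  -- A value below 1 confines the infimum to a compact interval, because the limit at infinity is 1.
  -- Otherwise s = 0, with value 1, is a minimizer.
  by_cases hex : ∃ s₀ ∈ Set.Ici (0 : ℝ), rcusExt κ ℓ np nd ρp ρd M s₀ < 1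
  · obtain ⟨s₀, hs₀, hlt⟩ := hex
    have hev : ∀ᶠ s in cocompact ℝ ⊓ 𝓟 (Set.Ici 0),
        rcusExt κ ℓ np nd ρp ρd M s₀ ≤ rcusExt κ ℓ np nd ρp ρd M s := by
      rw [cocompact_eq_atBot_atTop, inf_sup_right, eventually_sup]
      constructor
      · have : atBot ⊓ 𝓟 (Set.Ici (0 : ℝ)) = ⊥ := by
          rw [← disjoint_iff]
          exact (disjoint_principal_right.2 (by simpa using Iio_mem_atBot (0 : ℝ)))
        simp [this]
      · refine Eventually.filter_mono inf_le_left ?_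
        exact ((tendsto_rcusExt_atTop κ ρp M hnd hM).eventually_const_lt hlt).mono
          fun _ h => h.le
    obtain ⟨s, hs, hmin⟩ := (continuous_rcusExt (ℓ := ℓ) (np := np) (ρd := ρd) κ ρp M
      hnd).continuousOn.exists_isMinOn' isClosed_Ici hs₀ hev
    refine ⟨s, hs, fun t ht => ?_⟩
    have := hmin ht
    simp only [Set.mem_ofPred_eq] at this ⊢
    rwa [heq hs, heq ht]
  · push Not at hex
    refine ⟨0, Set.self_mem_Ici, fun t ht => ?_⟩
    simp only [Set.mem_ofPred_eq]
    rw [rcusAt_zero κ ρp M hnd hρd hM, heq ht]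
    exact hex t ht

theorem isLeast_epsUB (hnd : 0 < nd) (hρd : 0 ≤ ρd) (hM : 1 ≤ M) :
    IsLeast (rcusAt κ ℓ np nd ρp ρd M '' Set.Ici 0) (epsUB κ ℓ np nd ρp ρd M) := by
  obtain ⟨s, hs, hmin⟩ := exists_isMinOn_rcusAt (ℓ := ℓ) (np := np) κ ρp M hnd hρd hM
  have h : IsLeast (rcusAt κ ℓ np nd ρp ρd M '' Set.Ici 0) (rcusAt κ ℓ np nd ρp ρd M s) := by
    refine ⟨⟨s, hs, rfl⟩, ?_⟩
    rintro _ ⟨t, ht, rfl⟩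
    exact hmin ht
  rw [epsUB, h.csInf_eq]
  exact h

end rcusAt

end BlockFading
end

/-! ### Random-coding union bound and Chernoff bound -/

noncomputable section
namespace BlockFading

open scoped ENNReal Nat
open Filter Topology

section randomCoding
variable {X Ω : Type*} [MeasurableSpace X] [MeasurableSpace Ω] (Q : Measure X) (N : Measure Ω)
  [IsProbabilityMeasure Q] [IsProbabilityMeasure N] {E : Set (X × X × Ω)}

theorem measurableSet_exists_competitor (hE : MeasurableSet E) (n : ℕ) (x : X) :
    MeasurableSet {q : (Fin n → X) × Ω | ∃ i, (x, q.1 i, q.2) ∈ E} := by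
  have : {q : (Fin n → X) × Ω | ∃ i, (x, q.1 i, q.2) ∈ E} =
      ⋃ i, (fun q : (Fin n → X) × Ω => (x, q.1 i, q.2)) ⁻¹' E := by
    ext q
    simp
  rw [this]
  exact MeasurableSet.iUnion fun i => measurableSet_preimage (by fun_prop) hE

/-- Integrating over the competitors first, for fixed noise, allows the union bound to be capped at
1 inside the noise average. -/
theorem lintegral_competitor_le (hE : MeasurableSet E) (n : ℕ) (x : X) :
    ∫⁻ c, N {ω | ∃ i, (x, c i, ω) ∈ E} ∂(Measure.pi fun _ : Fin n => Q) ≤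
      ∫⁻ ω, min 1 (n * Q {x' | (x, x', ω) ∈ E}) ∂N := by
  have hm := measurableSet_exists_competitor hE n x
  have h1 := Measure.prod_apply (μ := Measure.pi fun _ : Fin n => Q) (ν := N) hm
  have h2 := Measure.prod_apply_symm (μ := Measure.pi fun _ : Fin n => Q) (ν := N) hm
  calc _ = ∫⁻ ω, (Measure.pi fun _ : Fin n => Q) {c | ∃ i, (x, c i, ω) ∈ E} ∂N := h1.symm.trans h2
    _ ≤ _ := by
      refine lintegral_mono fun ω => le_min prob_le_one ?_
      have hs : MeasurableSet {x' | (x, x', ω) ∈ E} :=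
        measurableSet_preimage (f := fun x' => (x, x', ω)) (by fun_prop) hE
      have : {c : Fin n → X | ∃ i, (x, c i, ω) ∈ E} =
          ⋃ i, (Function.eval i) ⁻¹' {x' | (x, x', ω) ∈ E} := by
        ext c
        simp
      rw [this]
      refine (measure_iUnion_le _).trans ?_
      simp only [fun i => (measurePreserving_eval (fun _ : Fin n => Q) i).measure_preimage
        hs.nullMeasurableSet]
      simp

theorem measurable_competitor (hE : MeasurableSet E) {M : ℕ} (j : Fin M) :
    Measurable fun c : Fin M → X => N {ω | ∃ m, m ≠ j ∧ (c j, c m, ω) ∈ E} := by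
  have hm : MeasurableSet {q : (Fin M → X) × Ω | ∃ m, m ≠ j ∧ (q.1 j, q.1 m, q.2) ∈ E} := by
    have : {q : (Fin M → X) × Ω | ∃ m, m ≠ j ∧ (q.1 j, q.1 m, q.2) ∈ E} =
        ⋃ m, ⋃ (_ : m ≠ j), (fun q : (Fin M → X) × Ω => (q.1 j, q.1 m, q.2)) ⁻¹' E := by
      ext q
      simp
    rw [this]
    exact MeasurableSet.iUnion fun m => MeasurableSet.iUnion fun _ =>
      measurableSet_preimage (by fun_prop) hE
  exact measurable_measure_prodMk_left hm

theorem lintegral_codebook_le (hE : MeasurableSet E) {n : ℕ} (j : Fin (n + 1)) :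
    ∫⁻ c, N {ω | ∃ m, m ≠ j ∧ (c j, c m, ω) ∈ E} ∂(Measure.pi fun _ : Fin (n + 1) => Q) ≤
      ∫⁻ x, ∫⁻ ω, min 1 (n * Q {x' | (x, x', ω) ∈ E}) ∂N ∂Q := by
  have hmp := (measurePreserving_piFinSuccAbove (fun _ : Fin (n + 1) => Q) j).symm
  have hf := measurable_competitor N hE j
  rw [← hmp.lintegral_comp hf]
  refine (lintegral_prod _ (hf.comp hmp.measurable).aemeasurable).le.trans ?_
  refine lintegral_mono fun x => (lintegral_mono fun c => measure_mono fun ω hω => ?_).trans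
    (lintegral_competitor_le Q N hE n x)
  obtain ⟨m, hm, hmE⟩ := hω
  obtain ⟨i, rfl⟩ := Fin.exists_succAbove_eq hm
  refine ⟨i, ?_⟩
  have hins : (MeasurableEquiv.piFinSuccAbove (fun _ : Fin (n + 1) => X) j).symm (x, c) =
      j.insertNth x c := rfl
  simpa only [hins, Fin.insertNth_apply_same, Fin.insertNth_apply_succAbove] using hmE

/-- Random coding: some codebook does at least as well as the random-coding union bound. -/
theorem exists_codebook (hE : MeasurableSet E) {P : X → Prop} (hP : ∀ᵐ x ∂Q, P x) (n : ℕ) :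
    ∃ c : Fin (n + 1) → X, (∀ m, P (c m)) ∧
      ∑ j, N {ω | ∃ m, m ≠ j ∧ (c j, c m, ω) ∈ E} ≤
        (n + 1 : ℕ) * ∫⁻ x, ∫⁻ ω, min 1 (n * Q {x' | (x, x', ω) ∈ E}) ∂N ∂Q := by
  have hnull : ∀ᵐ c ∂(Measure.pi fun _ : Fin (n + 1) => Q), ∀ m, P (c m) :=
    ae_all_iff.2 fun m =>
      (measurePreserving_eval (fun _ : Fin (n + 1) => Q) m).quasiMeasurePreserving.ae hP
  -- Some codebook is no worse than the average and also avoids the null set where `P` fails, so the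
  -- power constraint holds exactly.
  obtain ⟨c, hc, hle⟩ := exists_notMem_null_le_lintegral
    (μ := Measure.pi fun _ : Fin (n + 1) => Q)
    (f := fun c => ∑ j, N {ω | ∃ m, m ≠ j ∧ (c j, c m, ω) ∈ E})
    (Finset.measurable_sum _ fun j _ => measurable_competitor N hE j).aemeasurable
    (ae_iff.1 hnull)
  refine ⟨c, by simpa using hc, hle.trans ?_⟩
  rw [lintegral_finsetSum _ fun j _ => measurable_competitor N hE j]
  refine (Finset.sum_le_sum fun j _ => lintegral_codebook_le Q N hE j).trans ?_
  simp

end randomCoding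

theorem lintegral_pi_prod {ι X : Type*} [Fintype ι] [MeasurableSpace X] (μ : Measure X)
    [IsProbabilityMeasure μ] (f : ι → X → ℝ≥0∞) (hf : ∀ i, Measurable (f i)) :
    ∫⁻ x, ∏ i, f i (x i) ∂(Measure.pi fun _ : ι => μ) = ∏ i, ∫⁻ x, f i x ∂μ := by
  have hind : iIndepFun (fun i (x : ι → X) => f i (x i)) (Measure.pi fun _ : ι => μ) :=
    iIndepFun_pi (X := f) fun i => (hf i).aemeasurable
  have h := lintegral_prod_eq_prod_lintegral_of_indepFun Finset.univ _ hind
    fun i => (hf i).comp (measurable_pi_apply i)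
  refine (Eq.trans ?_ h).trans (Finset.prod_congr rfl fun i _ => ?_)
  · rfl
  · exact (measurePreserving_eval (fun _ : ι => μ) i).lintegral_comp (hf i)

/-- Here n = M - 1 counts the competitors. For n = 0 the left side is 0, in agreement with the
convention for M = 1. -/
theorem min_one_mul_exp_neg_le_rcusTerm (n : ℕ) (t : ℝ) :
    min 1 ((n : ℝ≥0∞) * ENNReal.ofReal (Real.exp (-t))) ≤ ENNReal.ofReal (rcusTerm (n + 1) t) := by
  rcases Nat.eq_zero_or_pos n with rfl | hn
  · simp
  rw [rcusTerm, if_neg (by omega)]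
  have hn' : (0 : ℝ) < n := by exact_mod_cast hn
  push_cast
  rw [add_sub_cancel_right]
  rcases le_total 0 (t - Real.log n) with h | h
  · rw [max_eq_right h]
    refine (min_le_right _ _).trans ?_
    rw [neg_sub, sub_eq_add_neg, Real.exp_add, Real.exp_log hn', ENNReal.ofReal_mul hn'.le,
      ENNReal.ofReal_natCast]
  · rw [max_eq_left h]
    simp

section chernoff
variable {n : ℕ}

theorem measurable_reInner_right (y : Fin n → ℂ) : Measurable fun x => reInner y x :=
  measurable_reInner.comp (measurable_const.prodMk measurable_id)

/-- On the sphere ‖e x‖ = ‖e x'‖, so only inner products survive in the difference of squared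
distances. Moving s·e to the other side of the inner product, conjugated, leaves the spherical
exponential mean. -/
theorem lintegral_exp_dist_shellLaw (hn : 0 < n) {R s : ℝ} (hR : 0 ≤ R) (hs : 0 ≤ s) (e : ℂ)
    (x y : Fin n → ℂ) (hx : l2norm x = R) :
    ∫⁻ x', ENNReal.ofReal (Real.exp (s * (l2norm (y - e • x) ^ 2 - l2norm (y - e • x') ^ 2)))
      ∂(shellLaw n R) = ENNReal.ofReal (Real.exp (-infoDensity R s e x y)) := by
  have hc : ∀ x', reInner y ((s * e) • x') = reInner (((s : ℂ) * (starRingEnd ℂ) e) • y) x' := by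
    intro x'
    simp only [reInner, Pi.smul_apply, smul_eq_mul, map_mul, Complex.conj_ofReal,
      Complex.conj_conj]
    congr 1
    refine Finset.sum_congr rfl fun i _ => ?_
    ring
  have hae : ∀ᵐ x' ∂(shellLaw n R),
      ENNReal.ofReal (Real.exp (s * (l2norm (y - e • x) ^ 2 - l2norm (y - e • x') ^ 2))) =
        ENNReal.ofReal (Real.exp (-(2 * s * reInner y (e • x)))) *
          ENNReal.ofReal (Real.exp (2 * reInner (((s : ℂ) * (starRingEnd ℂ) e) • y) x')) := by
    filter_upwards [ae_l2norm_shellLaw hn hR] with x' hx'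
    rw [← ENNReal.ofReal_mul (by positivity), ← Real.exp_add, ← hc, mul_smul, reInner_smul_smul,
      l2norm_sub_sq, l2norm_sub_sq, l2norm_smul, l2norm_smul, hx, hx']
    ring_nf
  have hpos : 0 < besselPhi n (s * ‖e‖ * l2norm y * R) :=
    zero_lt_one.trans_le (one_le_besselPhi hn _)
  have hnorm : R * l2norm (((s : ℂ) * (starRingEnd ℂ) e) • y) = s * ‖e‖ * l2norm y * R := by
    rw [l2norm_smul, norm_mul, Complex.norm_real, Real.norm_of_nonneg hs, RCLike.norm_conj]
    ring
  have hrhs : Real.exp (-infoDensity R s e x y) = Real.exp (-(2 * s * reInner y (e • x))) *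
      besselPhi n (s * ‖e‖ * l2norm y * R) := by
    rw [infoDensity, neg_sub, sub_eq_neg_add, Real.exp_add, Real.exp_log hpos]
  have hm' : Measurable fun x' : Fin n → ℂ =>
      ENNReal.ofReal (Real.exp (2 * reInner (((s : ℂ) * (starRingEnd ℂ) e) • y) x')) :=
    (Real.measurable_exp.comp ((measurable_reInner_right _).const_mul 2)).ennreal_ofReal
  rw [hrhs, ENNReal.ofReal_mul (Real.exp_pos _).le, ← hnorm,
    ← lintegral_exp_reInner_shellLaw hn hR, ← lintegral_const_mul _ hm']
  exact lintegral_congr_ae hae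

/-- Chernoff: the indicator is at most exp of s times the difference of total distances, which
factors over the independent blocks. -/
theorem measure_closer_le {ℓ : ℕ} (hn : 0 < n) {R s : ℝ} (hR : 0 ≤ R) (hs : 0 ≤ s) (e : Fin ℓ → ℂ)
    (x y : Fin ℓ → Fin n → ℂ) (hx : ∀ k, l2norm (x k) = R) :
    (Measure.pi fun _ : Fin ℓ => shellLaw n R)
        {x' | ∑ k, l2norm (y k - e k • x' k) ^ 2 ≤ ∑ k, l2norm (y k - e k • x k) ^ 2} ≤
      ENNReal.ofReal (Real.exp (-∑ k, infoDensity R s (e k) (x k) (y k))) := by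
  have hml := measurable_l2norm (n := n)
  rw [← Finset.sum_neg_distrib, Real.exp_sum, ENNReal.ofReal_prod_of_nonneg fun _ _ => by positivity]
  simp_rw [← fun k => lintegral_exp_dist_shellLaw hn hR hs (e k) (x k) (y k) (hx k)]
  have hmeas : ∀ k, Measurable fun x' : Fin n → ℂ => ENNReal.ofReal (Real.exp
      (s * (l2norm (y k - e k • x k) ^ 2 - l2norm (y k - e k • x') ^ 2))) := fun k => by fun_prop
  rw [← lintegral_pi_prod (shellLaw n R) _ hmeas]
  have hset : MeasurableSet {x' : Fin ℓ → Fin n → ℂ |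
      ∑ k, l2norm (y k - e k • x' k) ^ 2 ≤ ∑ k, l2norm (y k - e k • x k) ^ 2} :=
    measurableSet_le (by fun_prop) measurable_const
  rw [← lintegral_indicator_one hset]
  refine lintegral_mono fun x' => ?_
  rw [Set.indicator_apply]
  split_ifs with hz
  · have hz' : ∑ k, l2norm (y k - e k • x' k) ^ 2 ≤ ∑ k, l2norm (y k - e k • x k) ^ 2 := hz
    rw [← ENNReal.ofReal_prod_of_nonneg fun _ _ => by positivity, ← Real.exp_sum, ← Finset.mul_sum,
      Finset.sum_sub_distrib, Pi.one_apply, ← ENNReal.ofReal_one]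
    exact ENNReal.ofReal_le_ofReal (Real.one_le_exp (mul_nonneg hs (sub_nonneg.2 hz')))
  · exact zero_le

end chernoff

end BlockFading
end

/-! ### Law of the channel estimate; measurable decoding -/

noncomputable section
namespace BlockFading

open scoped ENNReal Nat
open Filter Topology

theorem measurable_append {a b : ℕ} :
    Measurable fun q : (Fin a → ℂ) × (Fin b → ℂ) => Fin.append q.1 q.2 := by
  refine measurable_pi_lambda _ fun i => Fin.addCases (fun j => ?_) (fun j => ?_) i
  · simp only [Fin.append_left]
    fun_prop
  · simp only [Fin.append_right]
    fun_prop

theorem noiseLaw_add (a b : ℕ) :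
    ((noiseLaw a).prod (noiseLaw b)).map (fun q => Fin.append q.1 q.2) = noiseLaw (a + b) := by
  refine (Measure.pi_eq fun s hs => ?_).symm
  rw [Measure.map_apply measurable_append (MeasurableSet.univ_pi hs)]
  have : (fun q : (Fin a → ℂ) × (Fin b → ℂ) => Fin.append q.1 q.2) ⁻¹' Set.univ.pi s =
      (Set.univ.pi fun i => s (Fin.castAdd b i)) ×ˢ (Set.univ.pi fun i => s (Fin.natAdd a i)) := by
    ext q
    simp only [Set.mem_preimage, Set.mem_pi, Set.mem_univ, true_imp_iff, Set.mem_prod]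
    constructor
    · intro h
      exact ⟨fun i => by simpa using h (Fin.castAdd b i), fun i => by simpa using h (Fin.natAdd a i)⟩
    · rintro ⟨h1, h2⟩ i
      refine Fin.addCases (fun j => ?_) (fun j => ?_) i
      · simpa using h1 j
      · simpa using h2 j
  rw [this, Measure.prod_prod, noiseLaw, noiseLaw, Measure.pi_pi, Measure.pi_pi,
    Fin.prod_univ_add]

section estimate
variable {np nd : ℕ}

theorem measurable_mlEstimate (p : Fin np → ℂ) : Measurable (mlEstimate p) := by
  unfold mlEstimate
  fun_prop

theorem measurable_pilotPart : Measurable (pilotPart : (Fin (np + nd) → ℂ) → Fin np → ℂ) := by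
  unfold pilotPart
  fun_prop

theorem measurable_dataPart : Measurable (dataPart : (Fin (np + nd) → ℂ) → Fin nd → ℂ) := by
  unfold dataPart
  fun_prop

theorem mlEstimate_smul_add (p u : Fin np → ℂ) (hp : l2norm p ≠ 0) (h : ℂ) :
    mlEstimate p (h • p + u) =
      h + ∑ i, (starRingEnd ℂ) (p i) / ((l2norm p ^ 2 : ℝ) : ℂ) * u i := by
  have h1 : ∑ i, (starRingEnd ℂ) (p i) * p i = ((l2norm p ^ 2 : ℝ) : ℂ) := by
    rw [l2norm_sq]
    push_cast
    exact Finset.sum_congr rfl fun i _ => by rw [mul_comm, Complex.mul_conj']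
  have h0 : ((l2norm p ^ 2 : ℝ) : ℂ) ≠ 0 := by
    exact_mod_cast pow_ne_zero 2 hp
  have h2 : ∑ i, (starRingEnd ℂ) (p i) * (h • p + u) i =
      h * ((l2norm p ^ 2 : ℝ) : ℂ) + ∑ i, (starRingEnd ℂ) (p i) * u i := by
    rw [← h1, Finset.mul_sum, ← Finset.sum_add_distrib]
    refine Finset.sum_congr rfl fun i _ => ?_
    simp
    ring
  rw [mlEstimate, h2, add_div, mul_div_cancel_right₀ _ h0, Finset.sum_div]
  congr 1
  exact Finset.sum_congr rfl fun i _ => by ring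

theorem l2norm_sq_of_norm_sq {ρp : ℝ} (p : Fin np → ℂ) (hp : ∀ i, ‖p i‖ ^ 2 = ρp) :
    l2norm p ^ 2 = np * ρp := by
  simp [l2norm_sq, hp]

/-- The estimate and the rotated data noise have the law that the bound uses. -/
theorem map_eq_blockLaw (κ : ℝ) (hnp : 0 < np) {ρp : ℝ} (hρp : 0 < ρp) (p : Fin np → ℂ)
    (hp : ∀ i, ‖p i‖ ^ 2 = ρp)
    (U : EuclideanSpace ℂ (Fin nd) ≃ₗᵢ[ℂ] EuclideanSpace ℂ (Fin nd)) :
    ((fadingLaw κ).prod (noiseLaw (np + nd))).map (fun q =>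
      ((q.1, mlEstimate p (q.1 • p + pilotPart q.2)), unitaryAct U (dataPart q.2))) =
        blockLaw κ np nd ρp := by
  have hml := measurable_mlEstimate p
  have hpp := measurable_pilotPart (np := np) (nd := nd)
  have hdp := measurable_dataPart (np := np) (nd := nd)
  have hU := measurable_unitaryAct U
  have hl := l2norm_sq_of_norm_sq p hp
  have hpos : 0 < np * ρp := by positivity
  have hl0 : l2norm p ≠ 0 := by
    intro h
    rw [h] at hl
    linarith
  set a : Fin np → ℂ := fun i => (starRingEnd ℂ) (p i) / ((l2norm p ^ 2 : ℝ) : ℂ) with ha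
  -- The estimation error is the linear functional `a` of the pilot noise, so this is its variance.
  -- It depends on the pilots only through their power.
  have hla : l2norm a ^ 2 = 1 / (np * ρp) := by
    have : ∀ i, ‖a i‖ ^ 2 = ρp / (np * ρp) ^ 2 := fun i => by
      rw [ha, hl, norm_div, RCLike.norm_conj, div_pow, hp i, Complex.norm_real,
        Real.norm_of_nonneg hpos.le]
    rw [l2norm_sq]
    simp only [this]
    rw [Finset.sum_const, Finset.card_univ, Fintype.card_fin, nsmul_eq_mul]
    field_simp
  have hT : Measurable fun q : ℂ × (Fin (np + nd) → ℂ) =>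
      ((q.1, mlEstimate p (q.1 • p + pilotPart q.2)), unitaryAct U (dataPart q.2)) := by
    fun_prop
  refine Measure.ext_of_lintegral _ fun f hf => ?_
  have hfT : Measurable fun q : ℂ × (Fin (np + nd) → ℂ) =>
      f ((q.1, mlEstimate p (q.1 • p + pilotPart q.2)), unitaryAct U (dataPart q.2)) := hf.comp hT
  have hG : Measurable fun q : ℂ × ℂ => ∫⁻ v, f (q, v) ∂(noiseLaw nd) := hf.lintegral_prod_right'
  rw [lintegral_map hf hT, lintegral_prod _ hfT.aemeasurable, blockLaw,
    lintegral_prod _ hf.aemeasurable, Measure.lintegral_compProd hG]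
  refine lintegral_congr fun h => ?_
  have hTh : Measurable fun w : Fin (np + nd) → ℂ =>
      f ((h, mlEstimate p (h • p + pilotPart w)), unitaryAct U (dataPart w)) := by
    fun_prop
  have hpd : ∀ q : (Fin np → ℂ) × (Fin nd → ℂ),
      f ((h, mlEstimate p (h • p + pilotPart (Fin.append q.1 q.2))),
        unitaryAct U (dataPart (Fin.append q.1 q.2))) =
      f ((h, h + ∑ i, a i * q.1 i), unitaryAct U q.2) := by
    intro q
    have e1 : pilotPart (Fin.append q.1 q.2) = q.1 := by
      funext i
      simp [pilotPart]
    have e2 : dataPart (Fin.append q.1 q.2) = q.2 := by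
      funext i
      simp [dataPart]
    rw [e1, e2, mlEstimate_smul_add p q.1 hl0]
  have hq : Measurable fun q : (Fin np → ℂ) × (Fin nd → ℂ) =>
      f ((h, h + ∑ i, a i * q.1 i), unitaryAct U q.2) := by
    fun_prop
  rw [← noiseLaw_add, lintegral_map hTh measurable_append, lintegral_congr hpd, lintegral_prod _ hq.aemeasurable]
  have hinner : ∀ u : Fin np → ℂ,
      ∫⁻ v, f ((h, h + ∑ i, a i * u i), unitaryAct U v) ∂(noiseLaw nd) =
        ∫⁻ v, f ((h, h + ∑ i, a i * u i), v) ∂(noiseLaw nd) := by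
    intro u
    conv_rhs => rw [← noiseLaw_map_unitaryAct U]
    rw [lintegral_map (by fun_prop) hU]
  have hker : cgaussKernel (1 / (np * ρp)) h =
      (noiseLaw np).map (fun u => h + ∑ i, a i * u i) := by
    change (cgaussZero (1 / (np * ρp))).map (fun z => h + z) = _
    rw [← hla, ← noiseLaw_map_linear, Measure.map_map (by fun_prop) (by fun_prop)]
    rfl
  have hGh : Measurable fun e : ℂ => ∫⁻ v, f ((h, e), v) ∂(noiseLaw nd) :=
    hG.comp measurable_prodMk_left
  rw [lintegral_congr hinner, hker, lintegral_map hGh (by fun_prop)]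

end estimate

/-- Induction on the number of candidates: the best of the earlier ones is compared with the last,
so the selection is a measurable case split. -/
theorem exists_measurable_argmin {Y : Type*} [MeasurableSpace Y] (n : ℕ)
    (D : Fin (n + 1) → Y → ℝ) (hD : ∀ m, Measurable (D m)) :
    ∃ g : Y → Fin (n + 1), Measurable g ∧ ∀ y m, D (g y) y ≤ D m y := by
  induction n with
  | zero => exact ⟨fun _ => 0, measurable_const, fun y m => by
      rw [show m = 0 from Fin.fin_one_eq_zero m]⟩
  | succ n ih =>
    obtain ⟨g, hg, hmin⟩ := ih (fun m => D m.castSucc) fun m => hD _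
    have hDu : Measurable fun q : Fin (n + 1) × Y => D q.1.castSucc q.2 :=
      measurable_from_prod_countable_right fun m => hD m.castSucc
    have hDg : Measurable fun y => D (g y).castSucc y :=
      hDu.comp (hg.prodMk measurable_id)
    classical
    refine ⟨fun y => if D (g y).castSucc y ≤ D (Fin.last _) y then (g y).castSucc else Fin.last _,
      Measurable.ite (measurableSet_le hDg (hD _))
        ((measurable_from_top (f := Fin.castSucc)).comp hg) measurable_const, fun y m => ?_⟩
    refine Fin.lastCases ?_ (fun i => ?_) m
    · dsimp only
      split_ifs with h
      · exact h
      · exact le_rfl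
    · dsimp only
      split_ifs with h
      · exact hmin y i
      · exact (not_le.1 h).le.trans (hmin y i)

end BlockFading
end

/-! ### The pilot-assisted code -/

noncomputable section
namespace BlockFading

open scoped ENNReal Nat
open Filter Topology

section bound
variable {n : ℕ}

/-- This direction suffices: `rcusTerm` is antitone, so passing to `tStat` only enlarges the bound.
-/
theorem tStat_le_infoDensity (hn : 0 < n) {ρd s : ℝ} (hρ : 0 ≤ ρd) (hs : 0 ≤ s) (h e : ℂ)
    (w : Fin n → ℂ) : tStat ρd s h e w ≤
      infoDensity (Real.sqrt (n * ρd)) s e (firstCoord (Real.sqrt (n * ρd) : ℂ))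
        (wBar ρd h w) := by
  rcases hs.eq_or_lt with rfl | hs
  · rw [tStat_zero hn hρ, infoDensity_zero]
    exact degenerateConst_nonpos hn
  · rw [tStat_eq_infoDensity_add hn hρ hs]
    linarith [degenerateTerm_nonpos hn (Real.sqrt (n * ρd)) e (wBar ρd h w)]

theorem measurable_tStat (hn : 0 < n) {ρd s : ℝ} (hρ : 0 ≤ ρd) (hs : 0 ≤ s) :
    Measurable fun b : (ℂ × ℂ) × (Fin n → ℂ) => tStat ρd s b.1.1 b.1.2 b.2 := by
  rcases hs.eq_or_lt with rfl | hs
  · simp only [tStat_zero hn hρ]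
    exact measurable_const
  · simp only [tStat_eq_infoDensity_add hn hρ hs]
    exact measurable_contStat hn ρd s

theorem infoDensity_unitaryAct (U : EuclideanSpace ℂ (Fin n) ≃ₗᵢ[ℂ] EuclideanSpace ℂ (Fin n))
    (R s : ℝ) (e : ℂ) (x y : Fin n → ℂ) :
    infoDensity R s e (unitaryAct U x) (unitaryAct U y) = infoDensity R s e x y := by
  rw [infoDensity, infoDensity, ← unitaryAct_smul, reInner_unitaryAct, l2norm_unitaryAct]

theorem infoDensity_eq_firstCoord {ρd : ℝ} (x : Fin n → ℂ) (hx : l2norm x = Real.sqrt (n * ρd))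
    {U : EuclideanSpace ℂ (Fin n) ≃ₗᵢ[ℂ] EuclideanSpace ℂ (Fin n)}
    (hU : unitaryAct U x = firstCoord (l2norm x : ℂ)) (s : ℝ) (h e : ℂ) (v : Fin n → ℂ) :
    infoDensity (Real.sqrt (n * ρd)) s e x (h • x + v) =
      infoDensity (Real.sqrt (n * ρd)) s e (firstCoord (Real.sqrt (n * ρd) : ℂ))
        (wBar ρd h (unitaryAct U v)) := by
  rw [← infoDensity_unitaryAct U, unitaryAct_add, unitaryAct_smul, hU, hx]
  congr 1
  rw [wBar]
  congr 1
  funext i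
  simp [firstCoord]

end bound

section pilotAssisted
variable {ℓ np nd : ℕ}

/-- The law of the fading coefficients and the noise in all blocks. -/
def channelNoise (κ : ℝ) (ℓ n : ℕ) : Measure ((Fin ℓ → ℂ) × (Fin ℓ → Fin n → ℂ)) :=
  (Measure.pi (fun _ : Fin ℓ => fadingLaw κ)).prod (Measure.pi (fun _ : Fin ℓ => noiseLaw n))

instance (κ : ℝ) (ℓ n : ℕ) : IsProbabilityMeasure (channelNoise κ ℓ n) := by
  unfold channelNoise
  infer_instance

/-- The channel estimate in block `k`. -/
def estimateAt (p : Fin ℓ → Fin np → ℂ) (ω : (Fin ℓ → ℂ) × (Fin ℓ → Fin (np + nd) → ℂ))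
    (k : Fin ℓ) : ℂ := mlEstimate (p k) (ω.1 k • p k + pilotPart (ω.2 k))

/-- The received data vector in block `k`. -/
def receivedAt (x : Fin ℓ → Fin nd → ℂ) (ω : (Fin ℓ → ℂ) × (Fin ℓ → Fin (np + nd) → ℂ))
    (k : Fin ℓ) : Fin nd → ℂ := ω.1 k • x k + dataPart (ω.2 k)

/-- Regrouping fading and noise by block gives a product measure, on which the blockwise law
applies. The rotations may differ between blocks, as they must follow the sent word. -/
theorem lintegral_channelNoise_eq (κ : ℝ) (hnp : 0 < np) {ρp : ℝ} (hρp : 0 < ρp)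
    (p : Fin ℓ → Fin np → ℂ) (hp : ∀ k i, ‖p k i‖ ^ 2 = ρp)
    (U : Fin ℓ → EuclideanSpace ℂ (Fin nd) ≃ₗᵢ[ℂ] EuclideanSpace ℂ (Fin nd))
    (f : (Fin ℓ → (ℂ × ℂ) × (Fin nd → ℂ)) → ℝ≥0∞) (hf : Measurable f) :
    ∫⁻ ω, f (fun k => ((ω.1 k, estimateAt p ω k), unitaryAct (U k) (dataPart (ω.2 k))))
        ∂(channelNoise κ ℓ (np + nd)) =
      ∫⁻ b, f b ∂(Measure.pi (fun _ : Fin ℓ => blockLaw κ np nd ρp)) := by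
  have hmp := measurePreserving_arrowProdEquivProdArrow ℂ (Fin (np + nd) → ℂ) (Fin ℓ)
    (fun _ => fadingLaw κ) (fun _ => noiseLaw (np + nd))
  have hpp := measurable_pilotPart (np := np) (nd := nd)
  have hdp := measurable_dataPart (np := np) (nd := nd)
  have hT : ∀ k, Measurable fun q : ℂ × (Fin (np + nd) → ℂ) =>
      ((q.1, mlEstimate (p k) (q.1 • p k + pilotPart q.2)), unitaryAct (U k) (dataPart q.2)) := by
    intro k
    have hml := measurable_mlEstimate (p k)
    have hU := measurable_unitaryAct (U k)
    fun_prop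
  have hmap := fun k => map_eq_blockLaw κ hnp hρp (p k) (hp k) (U k)
  have hsf : ∀ k : Fin ℓ, SigmaFinite (((fadingLaw κ).prod (noiseLaw (np + nd))).map (fun q =>
      ((q.1, mlEstimate (p k) (q.1 • p k + pilotPart q.2)),
        unitaryAct (U k) (dataPart q.2)))) := fun k => by
    rw [hmap k]
    infer_instance
  have hpi := Measure.pi_map_pi (μ := fun _ : Fin ℓ => (fadingLaw κ).prod (noiseLaw (np + nd)))
    fun k => (hT k).aemeasurable
  simp only [hmap] at hpi
  have hTpi : Measurable fun (c : Fin ℓ → ℂ × (Fin (np + nd) → ℂ)) k =>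
      (((c k).1, mlEstimate (p k) ((c k).1 • p k + pilotPart (c k).2)),
        unitaryAct (U k) (dataPart (c k).2)) :=
    measurable_pi_lambda _ fun k => (hT k).comp (measurable_pi_apply k)
  rw [channelNoise, ← hmp.lintegral_comp_emb (MeasurableEquiv.measurableEmbedding _), ← hpi,
    lintegral_map hf hTpi]
  rfl

theorem lintegral_rcusTerm_infoDensity_le (κ : ℝ) (hnp : 0 < np) (hnd : 0 < nd) {ρp ρd s : ℝ}
    (hρp : 0 < ρp) (hρd : 0 ≤ ρd) (hs : 0 ≤ s) (M : ℕ) (p : Fin ℓ → Fin np → ℂ)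
    (hp : ∀ k i, ‖p k i‖ ^ 2 = ρp) (x : Fin ℓ → Fin nd → ℂ)
    (hx : ∀ k, l2norm (x k) = Real.sqrt (nd * ρd)) :
    ∫⁻ ω, ENNReal.ofReal (rcusTerm M (∑ k,
        infoDensity (Real.sqrt (nd * ρd)) s (estimateAt p ω k) (x k) (receivedAt x ω k)))
        ∂(channelNoise κ ℓ (np + nd)) ≤
      ENNReal.ofReal (rcusAt κ ℓ np nd ρp ρd M s) := by
  choose U hU using fun k => exists_unitaryAct_eq_firstCoord (x k)
  have hmI := measurable_infoDensity hnd (Real.sqrt (nd * ρd)) s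
  have hmw := measurable_wBar (n := nd) ρd
  have hmt := measurable_tStat hnd hρd hs
  have hmr := (continuous_rcusTerm M).measurable
  have hw' : Measurable fun b : (ℂ × ℂ) × (Fin nd → ℂ) => wBar ρd b.1.1 b.2 :=
    hmw.comp (f := fun b : (ℂ × ℂ) × (Fin nd → ℂ) => (b.1.1, b.2)) (by fun_prop)
  have hmI' : Measurable fun b : (ℂ × ℂ) × (Fin nd → ℂ) => infoDensity (Real.sqrt (nd * ρd)) s
      b.1.2 (firstCoord (Real.sqrt (nd * ρd) : ℂ)) (wBar ρd b.1.1 b.2) :=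
    hmI.comp (f := fun b : (ℂ × ℂ) × (Fin nd → ℂ) =>
        (b.1.2, firstCoord (Real.sqrt (nd * ρd) : ℂ), wBar ρd b.1.1 b.2)) (by fun_prop)
  have hint : Integrable (fun b : Fin ℓ → (ℂ × ℂ) × (Fin nd → ℂ) =>
      rcusTerm M (∑ k, tStat ρd s (b k).1.1 (b k).1.2 (b k).2))
      (Measure.pi (fun _ : Fin ℓ => blockLaw κ np nd ρp)) :=
    Integrable.of_bound (C := 1) (by
      refine Measurable.aestronglyMeasurable (hmr.comp ?_)
      exact Finset.measurable_sum _ fun k _ => hmt.comp (measurable_pi_apply k))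
      (ae_of_all _ fun b => norm_rcusTerm_le_one M _)
  have hmf : Measurable fun b : Fin ℓ → (ℂ × ℂ) × (Fin nd → ℂ) =>
      ENNReal.ofReal (rcusTerm M (∑ k, infoDensity (Real.sqrt (nd * ρd)) s (b k).1.2
        (firstCoord (Real.sqrt (nd * ρd) : ℂ)) (wBar ρd (b k).1.1 (b k).2))) := by
    refine (hmr.comp ?_).ennreal_ofReal
    exact Finset.measurable_sum _ fun k _ => hmI'.comp (measurable_pi_apply k)
  have h1 := lintegral_channelNoise_eq κ hnp hρp p hp U _ hmf
  rw [rcusAt, ofReal_integral_eq_lintegral_ofReal hint (ae_of_all _ fun b => rcusTerm_nonneg M _)]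
  calc _ = _ := lintegral_congr fun ω => by
        simp only [receivedAt, infoDensity_eq_firstCoord _ (hx _) (hU _)]
    _ = _ := h1
    _ ≤ _ := lintegral_mono fun b => ENNReal.ofReal_le_ofReal (antitone_rcusTerm M
        (Finset.sum_le_sum fun k _ => tStat_le_infoDensity hnd hρd hs _ _ _))

/-- The triples (sent data, competing data, noise) for which the competitor has at least as
large a metric. -/
def competitorSet (p : Fin ℓ → Fin np → ℂ) : Set ((Fin ℓ → Fin nd → ℂ) × (Fin ℓ → Fin nd → ℂ) ×
    ((Fin ℓ → ℂ) × (Fin ℓ → Fin (np + nd) → ℂ))) :=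
  {q | ∑ k, l2norm (receivedAt q.1 q.2.2 k - estimateAt p q.2.2 k • q.2.1 k) ^ 2 ≤
    ∑ k, l2norm (receivedAt q.1 q.2.2 k - estimateAt p q.2.2 k • q.1 k) ^ 2}

theorem measurableSet_competitorSet (p : Fin ℓ → Fin np → ℂ) :
    MeasurableSet (competitorSet (nd := nd) p) := by
  have hml := fun k => measurable_mlEstimate (p k)
  have hpp := measurable_pilotPart (np := np) (nd := nd)
  have hdp := measurable_dataPart (np := np) (nd := nd)
  have hl := measurable_l2norm (n := nd)
  unfold competitorSet receivedAt estimateAt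
  refine measurableSet_le (Finset.measurable_sum _ fun k _ => ?_)
    (Finset.measurable_sum _ fun k _ => ?_)
  · have := hml k
    fun_prop
  · have := hml k
    fun_prop

theorem lintegral_randomCoding_le (κ : ℝ) (hnp : 0 < np) (hnd : 0 < nd) {ρp ρd s : ℝ}
    (hρp : 0 < ρp) (hρd : 0 ≤ ρd) (hs : 0 ≤ s) (n : ℕ) (p : Fin ℓ → Fin np → ℂ)
    (hp : ∀ k i, ‖p k i‖ ^ 2 = ρp) (x : Fin ℓ → Fin nd → ℂ)
    (hx : ∀ k, l2norm (x k) = Real.sqrt (nd * ρd)) :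
    ∫⁻ ω, min 1 (n * (Measure.pi fun _ : Fin ℓ => shellLaw nd (Real.sqrt (nd * ρd)))
        {x' | (x, x', ω) ∈ competitorSet p}) ∂(channelNoise κ ℓ (np + nd)) ≤
      ENNReal.ofReal (rcusAt κ ℓ np nd ρp ρd (n + 1) s) := by
  refine le_trans (lintegral_mono fun ω => ?_)
    (lintegral_rcusTerm_infoDensity_le κ hnp hnd hρp hρd hs (n + 1) p hp x hx)
  refine le_trans ?_ (min_one_mul_exp_neg_le_rcusTerm n _)
  gcongr
  exact measure_closer_le hnd (Real.sqrt_nonneg _) hs (estimateAt p ω) x (receivedAt x ω) hx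

theorem channelLaw_eq_map (κ : ℝ) {n : ℕ} (x : Fin ℓ → Fin n → ℂ) :
    channelLaw κ x = (channelNoise κ ℓ n).map (fun ω k => ω.1 k • x k + ω.2 k) := rfl

theorem measurable_channel {n : ℕ} (x : Fin ℓ → Fin n → ℂ) :
    Measurable fun (ω : (Fin ℓ → ℂ) × (Fin ℓ → Fin n → ℂ)) k => ω.1 k • x k + ω.2 k := by
  fun_prop

/-- The exponent of the nearest-neighbour metric. -/
def nnDist (f : Fin ℓ → Fin (np + nd) → ℂ) (y : Fin ℓ → Fin (np + nd) → ℂ) : ℝ :=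
  ∑ k, l2norm (fun i => dataPart (y k) i -
    mlEstimate (pilotPart (f k)) (pilotPart (y k)) * dataPart (f k) i) ^ 2

theorem measurable_nnDist (f : Fin ℓ → Fin (np + nd) → ℂ) : Measurable (nnDist f) := by
  have hpp := measurable_pilotPart (np := np) (nd := nd)
  have hdp := measurable_dataPart (np := np) (nd := nd)
  have hl := measurable_l2norm (n := nd)
  refine Finset.measurable_sum _ fun k _ => ?_
  have := measurable_mlEstimate (pilotPart (f k))
  fun_prop

theorem prod_nnMetric (f y : Fin ℓ → Fin (np + nd) → ℂ) :
    ∏ k, nnMetric (f k) (y k) = Real.exp (-nnDist f y) := by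
  rw [nnDist, ← Finset.sum_neg_distrib, Real.exp_sum]
  rfl

theorem nnDist_append (p : Fin ℓ → Fin np → ℂ) (x x' : Fin ℓ → Fin nd → ℂ)
    (ω : (Fin ℓ → ℂ) × (Fin ℓ → Fin (np + nd) → ℂ)) :
    nnDist (fun k => Fin.append (p k) (x' k))
        (fun k => ω.1 k • Fin.append (p k) (x k) + ω.2 k) =
      ∑ k, l2norm (receivedAt x ω k - estimateAt p ω k • x' k) ^ 2 := by
  refine Finset.sum_congr rfl fun k _ => ?_
  have e1 : pilotPart (Fin.append (p k) (x' k)) = p k := by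
    funext i
    simp [pilotPart]
  have e2 : dataPart (Fin.append (p k) (x' k)) = x' k := by
    funext i
    simp [dataPart]
  have e3 : pilotPart (ω.1 k • Fin.append (p k) (x k) + ω.2 k) =
      ω.1 k • p k + pilotPart (ω.2 k) := by
    funext i
    simp [pilotPart]
  have e4 : dataPart (ω.1 k • Fin.append (p k) (x k) + ω.2 k) =
      ω.1 k • x k + dataPart (ω.2 k) := by
    funext i
    simp [dataPart]
  rw [e1, e2, e3, e4]
  rfl

theorem exists_pilotAssisted_code (κ : ℝ) (hnp : 0 < np) (hnd : 0 < nd) {ρ ρp ρd : ℝ}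
    (hρp : 0 < ρp) (hρd : 0 ≤ ρd) (hpow : np * ρp + nd * ρd = ((np + nd : ℕ) : ℝ) * ρ)
    {M : ℕ} (hM : 1 ≤ M) (p : Fin ℓ → Fin np → ℂ) (hp : ∀ k i, ‖p k i‖ ^ 2 = ρp) :
    ∃ (f : Fin M → Fin ℓ → Fin (np + nd) → ℂ) (g : (Fin ℓ → Fin (np + nd) → ℂ) → Fin M),
      (∀ m k, pilotPart (f m k) = p k) ∧
      (∀ m k, l2norm (dataPart (f m k)) ^ 2 = nd * ρd) ∧
      IsNNDecoder f g ∧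
      IsCode κ ℓ (np + nd) M (epsUB κ ℓ np nd ρp ρd M) ρ f g := by
  -- Attainment is what gives error exactly `epsUB` rather than `epsUB` plus a slack.
  obtain ⟨s, hs, hseq⟩ := (isLeast_epsUB (ℓ := ℓ) (np := np) κ ρp M hnd hρd hM).1
  obtain ⟨n, rfl⟩ : ∃ n, M = n + 1 := ⟨M - 1, by omega⟩
  set R := Real.sqrt (nd * ρd) with hR
  have hshell : ∀ᵐ x ∂(Measure.pi fun _ : Fin ℓ => shellLaw nd R), ∀ k, l2norm (x k) = R :=
    ae_all_iff.2 fun k => (measurePreserving_eval (fun _ : Fin ℓ => shellLaw nd R)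
      k).quasiMeasurePreserving.ae (ae_l2norm_shellLaw hnd (Real.sqrt_nonneg _))
  obtain ⟨c, hc, hsum⟩ := exists_codebook (Measure.pi fun _ : Fin ℓ => shellLaw nd R)
    (channelNoise κ ℓ (np + nd)) (measurableSet_competitorSet p) hshell n
  have hbound := lintegral_mono_ae (hshell.mono fun x hx =>
    lintegral_randomCoding_le κ hnp hnd hρp hρd hs n p hp x hx)
  rw [lintegral_const, measure_univ, mul_one, hseq] at hbound
  set f : Fin (n + 1) → Fin ℓ → Fin (np + nd) → ℂ := fun m k => Fin.append (p k) (c m k) with hf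
  obtain ⟨g, hg, hmin⟩ := exists_measurable_argmin n (fun m => nnDist (f m))
    fun m => measurable_nnDist (f m)
  have hpilot : ∀ m k, pilotPart (f m k) = p k := fun m k => by
    funext i
    simp [pilotPart, hf]
  have hdata : ∀ m k, dataPart (f m k) = c m k := fun m k => by
    funext i
    simp [dataPart, hf]
  have hR2 : R ^ 2 = nd * ρd := Real.sq_sqrt (by positivity)
  refine ⟨f, g, hpilot, fun m k => by rw [hdata, hc, hR2], ?_, ?_, hg, ?_⟩
  · intro y m
    rw [prod_nnMetric, prod_nnMetric]
    exact Real.exp_le_exp.2 (neg_le_neg (hmin y m))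
  · intro m k
    have : l2norm (f m k) ^ 2 = l2norm (pilotPart (f m k)) ^ 2 + l2norm (dataPart (f m k)) ^ 2 := by
      rw [l2norm_sq, l2norm_sq, l2norm_sq, Fin.sum_univ_add]
      rfl
    rw [this, hpilot, hdata, hc, hR2, l2norm_sq_of_norm_sq (p k) (hp k), hpow]
  · have herr : ∀ j, channelLaw κ (f j) {y | g y ≠ j} ≤ channelNoise κ ℓ (np + nd)
        {ω | ∃ m, m ≠ j ∧ (c j, c m, ω) ∈ competitorSet p} := by
      intro j
      have hset : MeasurableSet {y | g y ≠ j} := (hg (measurableSet_singleton j)).compl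
      rw [channelLaw_eq_map, Measure.map_apply (measurable_channel _) hset]
      -- The decoded message is itself the competitor. Ties already count as errors in
      -- `competitorSet`, so the tie-breaking rule is immaterial.
      refine measure_mono fun ω hω => ⟨_, hω, ?_⟩
      have := hmin (fun k => ω.1 k • f j k + ω.2 k) j
      rw [hf, nnDist_append, nnDist_append] at this
      exact this
    have htot : ∑ j, channelLaw κ (f j) {y | g y ≠ j} ≤
        ENNReal.ofReal ((n + 1 : ℕ) * epsUB κ ℓ np nd ρp ρd (n + 1)) := by
      rw [ENNReal.ofReal_mul (by positivity), ENNReal.ofReal_natCast]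
      exact (Finset.sum_le_sum fun j _ => herr j).trans (hsum.trans (by gcongr))
    have hprob : ∀ j, IsProbabilityMeasure (channelLaw κ (f j)) := fun j => by
      rw [channelLaw_eq_map]
      exact Measure.isProbabilityMeasure_map (measurable_channel _).aemeasurable
    have hnn : 0 ≤ epsUB κ ℓ np nd ρp ρd (n + 1) := by
      rw [← hseq]
      exact integral_nonneg fun b => rcusTerm_nonneg _ _
    have hreal : ∑ j, (channelLaw κ (f j)).real {y | g y ≠ j} ≤
        (n + 1 : ℕ) * epsUB κ ℓ np nd ρp ρd (n + 1) := by
      have := ENNReal.toReal_mono ENNReal.ofReal_ne_top htot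
      rwa [ENNReal.toReal_sum fun j _ => measure_ne_top _ _,
        ENNReal.toReal_ofReal (by positivity)] at this
    rw [one_div, inv_mul_le_iff₀ (by positivity)]
    exact hreal

end pilotAssisted

end BlockFading
end

/-! ### Finiteness of the maximum coding rate -/

noncomputable section
namespace BlockFading

open scoped ENNReal
open Filter Topology

/-- The product measure is generated by a premeasure multiplicative in the coordinate projections,
so the one-coordinate bounds multiply at that level. -/
theorem measure_pi_le_smul {ι : Type*} [Fintype ι] {α : ι → Type*} [∀ i, MeasurableSpace (α i)]
    {μ ν : ∀ i, Measure (α i)} {c : ℝ≥0∞} (hc : c ≠ ∞) (h : ∀ i, μ i ≤ c • ν i) :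
    Measure.pi μ ≤ c ^ Fintype.card ι • Measure.pi ν := by
  have hpre : (OuterMeasure.pi fun i => (μ i).toOuterMeasure) ≤
      c ^ Fintype.card ι • OuterMeasure.pi fun i => (ν i).toOuterMeasure := by
    rw [OuterMeasure.pi, OuterMeasure.pi, OuterMeasure.smul_boundedBy (ENNReal.pow_ne_top hc)]
    refine OuterMeasure.le_boundedBy.2 fun s => (OuterMeasure.boundedBy_le s).trans ?_
    simp only [piPremeasure, Pi.smul_apply, smul_eq_mul]
    calc _ ≤ ∏ i, (c * ν i (Function.eval i '' s)) :=
          Finset.prod_le_prod' fun i _ => Measure.le_iff'.1 (h i) _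
      _ = _ := by rw [Finset.prod_mul_distrib, Finset.prod_const, Finset.card_univ]; rfl
  refine Measure.le_iff.2 fun s hs => ?_
  rw [Measure.smul_apply, Measure.pi, Measure.pi, toMeasure_apply _ _ hs, toMeasure_apply _ _ hs]
  exact hpre s

theorem exists_noiseLaw_le_volume (ℓ n : ℕ) : ∃ C : ℝ≥0∞, C ≠ ∞ ∧
    Measure.pi (fun _ : Fin ℓ => noiseLaw n) ≤ C • (volume : Measure (Fin ℓ → Fin n → ℂ)) := by
  have h1 : cgauss 0 1 ≤ ENNReal.ofReal Real.pi⁻¹ • (volume : Measure ℂ) := by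
    rw [cgauss_zero, cgaussZero_one_eq_withDensity, ← withDensity_const]
    refine withDensity_mono (ae_of_all _ fun z => ENNReal.ofReal_le_ofReal ?_)
    have : Real.exp (-‖z‖ ^ 2) ≤ 1 := Real.exp_le_one_iff.2 (by simp)
    have := inv_pos.2 Real.pi_pos
    nlinarith
  have h2 := measure_pi_le_smul (ι := Fin n) ENNReal.ofReal_ne_top fun _ => h1
  have h3 := measure_pi_le_smul (ι := Fin ℓ) (μ := fun _ => noiseLaw n)
    (ν := fun _ => (volume : Measure (Fin n → ℂ)))
    (ENNReal.pow_ne_top ENNReal.ofReal_ne_top) fun _ => h2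
  exact ⟨_, ENNReal.pow_ne_top (ENNReal.pow_ne_top ENNReal.ofReal_ne_top), h3⟩

theorem exists_measure_norm_gt_le {E : Type*} [NormedAddCommGroup E] [MeasurableSpace E]
    [OpensMeasurableSpace E] (μ : Measure E) [IsProbabilityMeasure μ] {δ : ℝ≥0∞} (hδ : 0 < δ) :
    ∃ K : ℕ, μ {x | (K : ℝ) < ‖x‖} ≤ δ := by
  have hlim := tendsto_measure_iInter_atTop (μ := μ) (s := fun K : ℕ => {x : E | (K : ℝ) < ‖x‖})
    (fun K => (measurableSet_lt measurable_const measurable_norm).nullMeasurableSet)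
    (fun K L hKL x (hx : (L : ℝ) < ‖x‖) =>
      show (K : ℝ) < ‖x‖ from lt_of_le_of_lt (Nat.cast_le.2 hKL) hx) ⟨0, measure_ne_top _ _⟩
  have hempty : ⋂ K : ℕ, {x : E | (K : ℝ) < ‖x‖} = ∅ := by
    refine Set.eq_empty_of_forall_notMem fun x hx => ?_
    obtain ⟨K, hK⟩ := exists_nat_gt ‖x‖
    exact absurd (Set.mem_iInter.1 hx K) (not_lt.2 hK.le)
  rw [hempty, measure_empty] at hlim
  obtain ⟨K, hK⟩ := (hlim.eventually_lt_const hδ).exists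
  exact ⟨K, hK.le⟩

section converse
variable {ℓ n : ℕ}

theorem norm_channel_le {B K : ℝ} (hB : 0 ≤ B) (x : Fin ℓ → Fin n → ℂ) (hx : ∀ k, l2norm (x k) ≤ B)
    (ω : (Fin ℓ → ℂ) × (Fin ℓ → Fin n → ℂ)) (hω : ‖ω‖ ≤ K) :
    ‖fun k => ω.1 k • x k + ω.2 k‖ ≤ K * B + K := by
  have hK : 0 ≤ K := (norm_nonneg _).trans hω
  have h1 : ‖ω.1‖ ≤ K := (norm_fst_le ω).trans hω
  have h2 : ‖ω.2‖ ≤ K := (norm_snd_le ω).trans hω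
  refine (pi_norm_le_iff_of_nonneg (by positivity)).2 fun k =>
    (pi_norm_le_iff_of_nonneg (by positivity)).2 fun i => ?_
  have h3 : ‖ω.1 k‖ ≤ K := (norm_le_pi_norm ω.1 k).trans h1
  have h4 : ‖ω.2 k i‖ ≤ K := (norm_le_pi_norm (ω.2 k) i).trans ((norm_le_pi_norm ω.2 k).trans h2)
  have h5 : ‖x k i‖ ≤ B := by
    refine le_trans ?_ (hx k)
    rw [l2norm_eq_norm]
    exact PiLp.norm_apply_le (WithLp.toLp 2 (x k)) i
  calc ‖ω.1 k * x k i + ω.2 k i‖ ≤ ‖ω.1 k * x k i‖ + ‖ω.2 k i‖ := norm_add_le _ _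
    _ ≤ K * B + K := by
      rw [norm_mul]
      gcongr

/-- Up to a tail, the channel output has a bounded density. -/
theorem channelLaw_le (κ : ℝ) {B : ℝ} (hB : 0 ≤ B) {δ : ℝ≥0∞} (hδ : 0 < δ) :
    ∃ (C : ℝ≥0∞) (L : ℝ), C ≠ ∞ ∧ ∀ x : Fin ℓ → Fin n → ℂ, (∀ k, l2norm (x k) ≤ B) →
      ∀ D, MeasurableSet D →
        channelLaw κ x D ≤ δ + C * volume (D ∩ Metric.closedBall 0 L) := by
  obtain ⟨K, hK⟩ := exists_measure_norm_gt_le (channelNoise κ ℓ n) hδ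
  obtain ⟨C, hC, hle⟩ := exists_noiseLaw_le_volume ℓ n
  refine ⟨C, K * B + K, hC, fun x hx D hD => ?_⟩
  set S := D ∩ Metric.closedBall (0 : Fin ℓ → Fin n → ℂ) (K * B + K) with hS
  have hSm : MeasurableSet S := hD.inter Metric.isClosed_closedBall.measurableSet
  have hch := measurable_channel x
  rw [channelLaw_eq_map, Measure.map_apply hch hD]
  have hsub : (fun (ω : (Fin ℓ → ℂ) × (Fin ℓ → Fin n → ℂ)) k => ω.1 k • x k + ω.2 k) ⁻¹' D ⊆
      {ω | (K : ℝ) < ‖ω‖} ∪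
        (fun (ω : (Fin ℓ → ℂ) × (Fin ℓ → Fin n → ℂ)) k => ω.1 k • x k + ω.2 k) ⁻¹' S := by
    intro ω hω
    by_cases h : (K : ℝ) < ‖ω‖
    · exact Or.inl h
    · exact Or.inr ⟨hω, mem_closedBall_zero_iff.2 (norm_channel_le hB x hx ω (not_lt.1 h))⟩
  refine (measure_mono hsub).trans ((measure_union_le _ _).trans (add_le_add hK ?_))
  rw [channelNoise, Measure.prod_apply (hch hSm)]
  -- Given the fading, the output is a translate of the noise. Lebesgue measure is translation
  -- invariant, so the bound does not see the codeword.
  calc _ ≤ ∫⁻ _, C * volume S ∂(Measure.pi fun _ : Fin ℓ => fadingLaw κ) := by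
        refine lintegral_mono fun h => ?_
        refine (Measure.le_iff'.1 hle _).trans ?_
        have : Prod.mk h ⁻¹' ((fun (ω : (Fin ℓ → ℂ) × (Fin ℓ → Fin n → ℂ)) k =>
            ω.1 k • x k + ω.2 k) ⁻¹' S) = (fun w => (fun k => h k • x k) + w) ⁻¹' S := rfl
        rw [Measure.smul_apply, smul_eq_mul, this, measure_preimage_add]
    _ = C * volume S := by simp

instance (κ : ℝ) (x : Fin ℓ → Fin n → ℂ) : IsProbabilityMeasure (channelLaw κ x) := by
  rw [channelLaw_eq_map]
  exact Measure.isProbabilityMeasure_map (measurable_channel _).aemeasurable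

/-- For a fixed error probability below one, the number of messages is bounded. -/
theorem exists_card_le_of_isCode (κ : ℝ) (ℓ n : ℕ) {ε : ℝ} (hε : ε < 1) (ρ : ℝ) :
    ∃ B : ℕ, ∀ (M : ℕ) (f : Fin M → Fin ℓ → Fin n → ℂ) (g : (Fin ℓ → Fin n → ℂ) → Fin M),
      IsCode κ ℓ n M ε ρ f g → M ≤ B := by
  -- Half of the success probability is conceded to the tail. Then M(1 - ε) ≤ Mδ + V, so M ≤ V/δ.
  set δ := (1 - ε) / 2 with hδ
  have hδ0 : 0 < δ := by rw [hδ]; linarith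
  obtain ⟨C, L, hC, hle⟩ := channelLaw_le (ℓ := ℓ) (n := n) κ (Real.sqrt_nonneg (n * ρ))
    (ENNReal.ofReal_pos.2 hδ0)
  set V := C * volume (Metric.closedBall (0 : Fin ℓ → Fin n → ℂ) L) with hV
  have hVfin : V ≠ ∞ := ENNReal.mul_ne_top hC measure_closedBall_lt_top.ne
  refine ⟨⌈V.toReal / δ⌉₊, fun M f g ⟨hf, hg, herr⟩ => ?_⟩
  -- A decoder into `Fin 0` cannot exist, which excludes M = 0.
  have hMpos : 0 < M := (g 0).pos
  have hD : ∀ j, MeasurableSet {y | g y = j} := fun j => hg (measurableSet_singleton j)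
  have hx : ∀ j k, l2norm (f j k) ≤ Real.sqrt (n * ρ) := fun j k =>
    Real.le_sqrt_of_sq_le (hf j k).le
  have hdisj : ∑ j, volume ({y | g y = j} ∩ Metric.closedBall 0 L) ≤
      volume (Metric.closedBall (0 : Fin ℓ → Fin n → ℂ) L) := by
    rw [← measure_biUnion_finset]
    · exact measure_mono (Set.iUnion₂_subset fun j _ => Set.inter_subset_right)
    · intro i _ j _ hij
      exact Set.disjoint_left.2 fun y hy hy' => hij (hy.1.symm.trans hy'.1)
    · exact fun j _ => (hD j).inter Metric.isClosed_closedBall.measurableSet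
  have hsum : ∑ j, channelLaw κ (f j) {y | g y = j} ≤ ENNReal.ofReal (M * δ) + V := by
    calc _ ≤ ∑ j, (ENNReal.ofReal δ + C * volume ({y | g y = j} ∩ Metric.closedBall 0 L)) :=
          Finset.sum_le_sum fun j _ => hle (f j) (hx j) _ (hD j)
      _ ≤ _ := by
        rw [Finset.sum_add_distrib, ← Finset.mul_sum, Finset.sum_const, Finset.card_univ,
          Fintype.card_fin, nsmul_eq_mul, ENNReal.ofReal_mul (by positivity),
          ENNReal.ofReal_natCast, hV]
        gcongr
  have hreal : ∑ j, (channelLaw κ (f j)).real {y | g y = j} ≤ M * δ + V.toReal := by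
    have := ENNReal.toReal_mono (ENNReal.add_ne_top.2 ⟨ENNReal.ofReal_ne_top, hVfin⟩) hsum
    rwa [ENNReal.toReal_sum fun j _ => measure_ne_top _ _, ENNReal.toReal_add
      ENNReal.ofReal_ne_top hVfin, ENNReal.toReal_ofReal (by positivity)] at this
  have hcompl : ∀ j, (channelLaw κ (f j)).real {y | g y = j} =
      1 - (channelLaw κ (f j)).real {y | g y ≠ j} := fun j => by
    have := probReal_compl_eq_one_sub (μ := channelLaw κ (f j)) (hD j)
    have h2 : {y | g y ≠ j} = {y | g y = j}ᶜ := rfl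
    rw [h2, this]
    ring
  simp only [hcompl] at hreal
  rw [Finset.sum_sub_distrib, Finset.sum_const, Finset.card_univ, Fintype.card_fin, nsmul_eq_mul,
    mul_one] at hreal
  have hM : (0 : ℝ) < M := by exact_mod_cast hMpos
  rw [one_div, inv_mul_le_iff₀ hM] at herr
  have hfin : (M : ℝ) ≤ V.toReal / δ := by
    rw [le_div_iff₀ hδ0]
    have : (M : ℝ) * ε = M - M * δ - M * δ := by rw [hδ]; ring
    linarith
  exact_mod_cast hfin.trans (Nat.le_ceil _)

theorem bddAbove_codeRates (κ : ℝ) (ℓ n : ℕ) {ε : ℝ} (hε : ε < 1) (ρ : ℝ) :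
    BddAbove (codeRates κ ℓ n ε ρ) := by
  obtain ⟨B, hB⟩ := exists_card_le_of_isCode κ ℓ n hε ρ
  refine ⟨Real.logb 2 B / (ℓ * n), ?_⟩
  rintro _ ⟨M, f, g, hcode, rfl⟩
  have hM : 0 < M := (g 0).pos
  have hMB : (M : ℝ) ≤ B := by exact_mod_cast hB M f g hcode
  have hM' : (0 : ℝ) < M := by exact_mod_cast hM
  have := Real.logb_le_logb_of_le one_lt_two hM' hMB
  gcongr

theorem IsCode.mono {κ : ℝ} {M : ℕ} {ε ε' ρ : ℝ} {f : Fin M → Fin ℓ → Fin n → ℂ}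
    {g : (Fin ℓ → Fin n → ℂ) → Fin M} (h : IsCode κ ℓ n M ε ρ f g) (hε : ε ≤ ε') :
    IsCode κ ℓ n M ε' ρ f g :=
  ⟨h.1, h.2.1, h.2.2.trans hε⟩

end converse

theorem epsUB_one (κ : ℝ) (ℓ np nd : ℕ) (ρp ρd : ℝ) : epsUB κ ℓ np nd ρp ρd 1 = 0 := by
  have : rcusAt κ ℓ np nd ρp ρd 1 '' Set.Ici 0 = {0} := by
    have h : rcusAt κ ℓ np nd ρp ρd 1 = fun _ => 0 := by
      funext s
      simp [rcusAt, rcusTerm_one]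
    rw [h]
    exact Set.nonempty_Ici.image_const 0
  rw [epsUB, this, csInf_singleton]

theorem exists_isGreatest_rate (κ : ℝ) {ℓ np nd : ℕ} (hnp : 0 < np) (hnd : 0 < nd) {ρ ρp ρd : ℝ}
    (hρp : 0 < ρp) (hρd : 0 ≤ ρd) (hpow : np * ρp + nd * ρd = ((np + nd : ℕ) : ℝ) * ρ)
    {ε : ℝ} (hε0 : 0 ≤ ε) (hε : ε < 1) :
    ∃ r : ℝ,
      IsGreatest {r : ℝ | ∃ M : ℕ, 1 ≤ M ∧ epsUB κ ℓ np nd ρp ρd M ≤ ε ∧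
        r = Real.logb 2 M / (((np + nd : ℕ) : ℝ) * ℓ)} r ∧
      BddAbove (codeRates κ ℓ (np + nd) ε ρ) ∧ r ≤ maxRate κ ℓ (np + nd) ε ρ := by
  obtain ⟨B, hB⟩ := exists_card_le_of_isCode κ ℓ (np + nd) hε ρ
  have hbdd := bddAbove_codeRates κ ℓ (np + nd) hε ρ
  have hcode : ∀ M : ℕ, 1 ≤ M → epsUB κ ℓ np nd ρp ρd M ≤ ε →
      ∃ (f : Fin M → Fin ℓ → Fin (np + nd) → ℂ) (g : (Fin ℓ → Fin (np + nd) → ℂ) → Fin M),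
        IsCode κ ℓ (np + nd) M ε ρ f g := by
    intro M hM hMε
    obtain ⟨f, g, -, -, -, h⟩ := exists_pilotAssisted_code (ℓ := ℓ) κ hnp hnd hρp hρd hpow hM
      (fun _ _ => (Real.sqrt ρp : ℂ)) fun _ _ => by
        rw [Complex.norm_real, Real.norm_of_nonneg (Real.sqrt_nonneg _), Real.sq_sqrt hρp.le]
    exact ⟨f, g, h.mono hMε⟩
  set S := {r : ℝ | ∃ M : ℕ, 1 ≤ M ∧ epsUB κ ℓ np nd ρp ρd M ≤ ε ∧
        r = Real.logb 2 M / (((np + nd : ℕ) : ℝ) * ℓ)} with hS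
  -- Each admissible M carries an actual code, so the bound on code sizes applies; no monotonicity
  -- of `epsUB` in M is needed.
  have hfin : S.Finite := by
    refine ((Set.finite_Iic B).image
      fun M : ℕ => Real.logb 2 M / (((np + nd : ℕ) : ℝ) * ℓ)).subset ?_
    rintro _ ⟨M, hM, hMε, rfl⟩
    obtain ⟨f, g, h⟩ := hcode M hM hMε
    exact ⟨M, hB M f g h, rfl⟩
  have hne : S.Nonempty := ⟨_, 1, le_rfl, by rwa [epsUB_one], rfl⟩
  obtain ⟨r, hr⟩ := hfin.isCompact.exists_isGreatest hne
  refine ⟨r, hr, hbdd, ?_⟩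
  obtain ⟨M, hM, hMε, rfl⟩ := hr.1
  obtain ⟨f, g, h⟩ := hcode M hM hMε
  exact le_csSup hbdd ⟨M, f, g, h, by rw [mul_comm]⟩

end BlockFading
end

theorem mainTheorem3 (κ : ℝ) (hκ : 0 ≤ κ) (ℓ np nd : ℕ) (hℓ : 0 < ℓ) (hnp : 0 < np) (hnd : 0 < nd)
    (ρ ρp ρd : ℝ) (hρp : 0 < ρp) (hρd : 0 ≤ ρd)
    (hpow : np * ρp + nd * ρd = ((np + nd : ℕ) : ℝ) * ρ) :
    -- the infimum over `s ≥ 0` that defines the bound is a minimum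
    (∀ M : ℕ, 1 ≤ M →
      IsLeast (rcusAt κ ℓ np nd ρp ρd M '' Set.Ici 0) (epsUB κ ℓ np nd ρp ρd M)) ∧
    -- the error probability is achieved by pilot-assisted transmission with any pilot vectors,
    -- data vectors on the shell, and nearest-neighbour decoding
    (∀ M : ℕ, 1 ≤ M → ∀ p : Fin ℓ → Fin np → ℂ, (∀ k i, ‖p k i‖ ^ 2 = ρp) →
      ∃ (f : Fin M → Fin ℓ → Fin (np + nd) → ℂ) (g : (Fin ℓ → Fin (np + nd) → ℂ) → Fin M),
        (∀ m k, pilotPart (f m k) = p k) ∧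
        (∀ m k, l2norm (dataPart (f m k)) ^ 2 = nd * ρd) ∧
        IsNNDecoder f g ∧
        IsCode κ ℓ (np + nd) M (epsUB κ ℓ np nd ρp ρd M) ρ f g) ∧
    -- the lower bound on the maximum coding rate
    (∀ ε : ℝ, 0 ≤ ε → ε < 1 →
      ∃ r : ℝ,
        IsGreatest {r : ℝ | ∃ M : ℕ, 1 ≤ M ∧ epsUB κ ℓ np nd ρp ρd M ≤ ε ∧
          r = Real.logb 2 M / (((np + nd : ℕ) : ℝ) * ℓ)} r ∧
        BddAbove (codeRates κ ℓ (np + nd) ε ρ) ∧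
        r ≤ maxRate κ ℓ (np + nd) ε ρ) := by
  exact ⟨fun M hM => isLeast_epsUB κ ρp M hnd hρd hM,
    fun M hM p hp => exists_pilotAssisted_code κ hnp hnd hρp hρd hpow hM p hp,
    fun ε hε0 hε => exists_isGreatest_rate κ hnp hnd hρp hρd hpow hε0 hε⟩
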